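/- Let $q\ge 2$. There exist constants $c_q, C_q\in(0,\infty)$ depending only on $q$ such that the following holds. Let $\mathcal T$ be a rooted tree with countable vertex set (finite or infinite, not necessarily locally finite), with root $\rho$, graph distance $d$ and natural partial order $\preceq$ (so $u\preceq v$ means that $u$ lies on the path from $\rho$ to $v$). Write $\mathcal T(v)=\{u: v\preceq u\}$ for the sub-tree starting at $v$ and $\mathcal C(v)=\{u\in\mathcal T(v): d(u,v)=1\}$ for the set of children of $v$. Let $\alpha:\mathcal T\to[0,\infty)$ be any weight, and let $X\ge 0$ be a random variable with $\mathbb E[X^q]<\infty$. Let $\{X(v)\}_{v\in\mathcal T\setminus\{\rho\}}$ be independent copies of $X$, set $X(\rho)\equiv 1$, and define $$\Theta_{\mathcal T}(X,\alpha)=\sum_{v\in\mathcal T}\alpha(v)\prod_{u\preceq v}X(u)\in[0,\infty],\qquad \Theta_{\mathcal T}(X^2,\beta)=\sum_{v\in\mathcal T}\beta(v)\prod_{u\preceq v}X(u)^2\in[0,\infty],$$ where the new weight $\beta:\mathcal T\to[0,\infty]$ is given by $$\beta(\rho)=\Big(\sum_{x\in\mathcal T}\alpha(x)(\mathbb E[X])^{d(x,\rho)}\Big)^2+\mathrm{Var}(X)\sum_{x\in\mathcal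 C(\rho)}\Big(\sum_{y\in\mathcal T(x)}\alpha(y)(\mathbb E[X])^{d(x,y)}\Big)^2$$ and, for $v\neq\rho$, $$\beta(v)=\mathrm{Var}(X)\sum_{x\in\mathcal C(v)}\Big(\sum_{y\in\mathcal T(x)}\alpha(y)(\mathbb E[X])^{d(x,y)}\Big)^2$$ (all sums and expectations of non-negative quantities are taken in $[0,\infty]$, with $0\cdot\infty=0$ and $0^0=1$). Then $$c_q\,\mathbb E\big[\Theta_{\mathcal T}(X^2,\beta)^{q/2}\big]\le \mathbb E\big[\Theta_{\mathcal T}(X,\alpha)^q\big],$$ and, if $\mathrm{Var}(X)>0$, $$\mathbb E\big[\Theta_{\mathcal T}(X,\alpha)^q\big]\le C_q\,\frac{\|X-\mathbb E[X]\|_q^q}{\mathrm{Var}(X)^{q/2}}\;\mathbb E\big[\Theta_{\mathcal T}(X^2,\beta)^{q/2}\big].$$ If $\mathrm{Var}(X)=0$, then $\mathbb E[\Theta_{\mathcal T}(X,\alpha)^q]=\mathbb E[\Theta_{\mathcal T}(X^2,\beta)^{q/2}]$. In particular the two moments are comparable, with constants depending only on $q$ and, when $\mathrm{Var}(X)>0$,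 on $\|X-\mathbb E[X]\|_q/\sqrt{\mathrm{Var}(X)}$. -/

import Mathlib

open MeasureTheory ProbabilityTheory
open scoped ENNReal NNReal

namespace TreeSum

universe u v

variable {V : Type u} {Ω : Type v}

/-- The natural partial order `u ⪯ v` of the tree `G` rooted at `ρ`:
the vertex `u` lies on the path from `ρ` to `v`. -/
def Below (G : SimpleGraph V) (ρ u v : V) : Prop :=
  ∃ p : G.Walk ρ v, p.IsPath ∧ u ∈ p.support

theorem finite_below {G : SimpleGraph V} (hG : G.IsTree) (ρ v : V) :
    {u : V | Below G ρ u v}.Finite := by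
  obtain ⟨p, -, hp⟩ := hG.existsUnique_path ρ v
  refine (List.finite_toSet p.support).subset ?_
  rintro u ⟨p', hp', hu⟩
  rw [hp p' hp'] at hu
  exact hu

/-- The finite set `{u : u ⪯ v}`; it contains both `ρ` and `v`. -/
noncomputable def ancestors {G : SimpleGraph V} (hG : G.IsTree) (ρ v : V) : Finset V :=
  (finite_below hG ρ v).toFinset

/-- The vertex set `T(v) = {u : v ⪯ u}` of the sub-tree starting from `v`. -/
def subtree (G : SimpleGraph V) (ρ v : V) : Set V :=
  {u | Below G ρ v u}

/-- The set `C(v) = {u : v ⪯ u, d(u, v) = 1}` of the children of `v`. -/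
def children (G : SimpleGraph V) (ρ v : V) : Set V :=
  {u | Below G ρ v u ∧ G.dist u v = 1}

open Classical in
/-- Extension of a family indexed by the non-root vertices by the value `1` at the root. -/
noncomputable def withRoot (ρ : V) (X : {v : V // v ≠ ρ} → Ω → ℝ) (v : V) (ω : Ω) : ℝ :=
  if h : v = ρ then 1 else X ⟨v, h⟩ ω

/-- The weighted sum `Θ_T(X, α) = ∑_v α(v) ∏_{u ⪯ v} X(u)` of a family of non-negative random
variables indexed by the non-root vertices, with `X(ρ) = 1`. It is a series of non-negative
terms and takes values in `[0, ∞]`. -/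
noncomputable def Theta {G : SimpleGraph V} (hG : G.IsTree) (ρ : V)
    (X : {v : V // v ≠ ρ} → Ω → ℝ) (α : V → ℝ≥0∞) (ω : Ω) : ℝ≥0∞ :=
  ∑' v : V, α v * ∏ u ∈ ancestors hG ρ v, ENNReal.ofReal (withRoot ρ X u ω)

open Classical in
/-- The new weight `β` built from the weight `α`, the mean `m` and the variance `s`. -/
noncomputable def newWeight (G : SimpleGraph V) (ρ : V) (α : V → ℝ≥0∞) (m s : ℝ≥0∞)
    (v : V) : ℝ≥0∞ :=
  if v = ρ then
    (∑' x : V, α x * m ^ G.dist x ρ) ^ 2 +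
      s * ∑' x : children G ρ ρ,
        (∑' y : subtree G ρ (x : V), α y * m ^ G.dist (x : V) (y : V)) ^ 2
  else
    s * ∑' x : children G ρ v,
      (∑' y : subtree G ρ (x : V), α y * m ^ G.dist (x : V) (y : V)) ^ 2

end TreeSum

/-! Reveal the factors `X(v)` one vertex at a time, parents before children, and average over the
rest. The conditional means of `Θ(X, α)` form a non-negative martingale `M`. When `x` is revealed
none of its descendants has been, so the conditional mean is affine in `X(x)`: its increment is
`b(x) (X(x) - E[X])`, where `b(x)` is the product over the strict ancestors of `x` times the mean
sum over the sub-tree of `x`. Thus `b(x)` is predictable and the conditional square function is `A =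
M_0 ^ 2 + Var(X) ∑ b(x) ^ 2`. The strict ancestors of `x` are the ancestors of its parent, and
grouping by parent turns `A` into exactly `Θ(X ^ 2, β)` (`weightedSum_newWeight`). The theorem is
therefore a Burkholder-Rosenthal inequality for `M`. The usual extra term, the sum of the `q`-th
moments of the increments, is controlled by `A` too: the increments are multiples of centred copies
of one variable, and `∑ D ^ (q/2) ≤ (∑ D) ^ (q/2)`.

Both bounds are proved by induction on the revealed set (`lowerSet_induction`). With `r = q/2`, the
lower one comes from `E[A^r] ≤ r E[A^(r-1) M^2]`, and the upper one from `E[M^q] ≤ 2K E[M^(q-1)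
A^(1/2)] + (1 + K + K κ) E[A^(q/2)]`, where `K = 2^q q^2` and `κ = E|X - E X|^q / Var(X)^(q/2)`. A
Young inequality bounds the mixed term by half of the left side plus the wanted moment. Absorbing
that half needs finite moments, hence finitely supported weights; monotone convergence gives the
general case. -/

namespace TreeSum

/-! ### Rooted trees: ancestors, parents, and induction over finite sub-trees -/

section Tree

variable {V : Type*} {G : SimpleGraph V}

theorem mem_ancestors {hG : G.IsTree} {ρ u v : V} : u ∈ ancestors hG ρ v ↔ Below G ρ u v := by
  simp [ancestors]

theorem length_eq_dist (hG : G.IsTree) {u v : V} {p : G.Walk u v} (hp : p.IsPath) :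
    p.length = G.dist u v := by
  obtain ⟨p', hp', h⟩ := hG.connected.exists_path_of_dist u v
  rw [(hG.existsUnique_path u v).unique hp hp', h]

theorem mem_ancestors_iff (hG : G.IsTree) {ρ u v : V} {p : G.Walk ρ v} (hp : p.IsPath) :
    u ∈ ancestors hG ρ v ↔ u ∈ p.support := by
  rw [mem_ancestors]
  refine ⟨?_, fun h => ⟨p, hp, h⟩⟩
  rintro ⟨p', hp', h⟩
  rwa [(hG.existsUnique_path ρ v).unique hp hp']

variable (hG : G.IsTree) (ρ : V)

theorem root_mem_ancestors (v : V) : ρ ∈ ancestors hG ρ v := by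
  obtain ⟨p, hp, -⟩ := hG.existsUnique_path ρ v
  exact (mem_ancestors_iff hG hp).2 p.start_mem_support

theorem self_mem_ancestors (v : V) : v ∈ ancestors hG ρ v := by
  obtain ⟨p, hp, -⟩ := hG.existsUnique_path ρ v
  exact (mem_ancestors_iff hG hp).2 p.end_mem_support

variable {hG ρ}

theorem ancestors_subset {u v : V} (h : u ∈ ancestors hG ρ v) :
    ancestors hG ρ u ⊆ ancestors hG ρ v := by
  classical
  obtain ⟨p, hp, -⟩ := hG.existsUnique_path ρ v
  rw [mem_ancestors_iff hG hp] at h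
  intro w hw
  rw [mem_ancestors_iff hG (hp.takeUntil h)] at hw
  exact (mem_ancestors_iff hG hp).2 (p.support_takeUntil_subset_support h hw)

/-- Cut the path to `v` at `u`: the vertex `w` falls on one of the two pieces. -/
theorem mem_ancestors_or {u v w : V} (hu : u ∈ ancestors hG ρ v) (hw : w ∈ ancestors hG ρ v) :
    u ∈ ancestors hG ρ w ∨ w ∈ ancestors hG ρ u := by
  classical
  obtain ⟨p, hp, -⟩ := hG.existsUnique_path ρ v
  rw [mem_ancestors_iff hG hp] at hu hw
  have e := p.take_spec hu
  rw [← e, SimpleGraph.Walk.mem_support_append_iff] at hw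
  rcases hw with hw | hw
  · exact Or.inr ((mem_ancestors_iff hG (hp.takeUntil hu)).2 hw)
  · left
    have e' := (p.dropUntil u hu).take_spec hw
    rw [← e', SimpleGraph.Walk.append_assoc] at e
    rw [← e] at hp
    refine (mem_ancestors_iff hG hp.of_append_left).2 ?_
    rw [SimpleGraph.Walk.mem_support_append_iff]
    exact Or.inl (SimpleGraph.Walk.end_mem_support _)

theorem dist_root_eq_add {u v : V} (h : u ∈ ancestors hG ρ v) :
    G.dist ρ v = G.dist ρ u + G.dist u v := by
  classical
  obtain ⟨p, hp, -⟩ := hG.existsUnique_path ρ v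
  rw [mem_ancestors_iff hG hp] at h
  rw [← length_eq_dist hG hp, ← length_eq_dist hG (hp.takeUntil h),
    ← length_eq_dist hG (hp.dropUntil h), ← SimpleGraph.Walk.length_append, p.take_spec h]

theorem card_ancestors (v : V) : (ancestors hG ρ v).card = G.dist ρ v + 1 := by
  classical
  obtain ⟨p, hp, -⟩ := hG.existsUnique_path ρ v
  have : ancestors hG ρ v = p.support.toFinset := by
    ext u; rw [mem_ancestors_iff hG hp, List.mem_toFinset]
  rw [this, List.toFinset_card_of_nodup hp.support_nodup, SimpleGraph.Walk.length_support,
    length_eq_dist hG hp]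

theorem eq_of_dist_root_le {u v : V} (h : u ∈ ancestors hG ρ v)
    (h' : G.dist ρ v ≤ G.dist ρ u) : u = v := by
  have := dist_root_eq_add h
  exact hG.connected.dist_eq_zero_iff.1 (by omega)

theorem eq_of_mem_ancestors {u v : V} (h : u ∈ ancestors hG ρ v) (h' : v ∈ ancestors hG ρ u) :
    u = v :=
  eq_of_dist_root_le h (by have := dist_root_eq_add h'; omega)

variable (hG ρ) in
theorem exists_parent {v : V} (hv : v ≠ ρ) : ∃ p ∈ ancestors hG ρ v, G.dist p v = 1 := by
  obtain ⟨p, hp, -⟩ := hG.existsUnique_path ρ v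
  refine ⟨p.penultimate, (mem_ancestors_iff hG hp).2 (p.getVert_mem_support _), ?_⟩
  rw [SimpleGraph.dist_eq_one_iff_adj]
  exact p.adj_penultimate (SimpleGraph.Walk.not_nil_of_ne hv.symm)

open Classical in
-- Ancestors of `v` form a chain graded by depth, which leaves no room between `p` and `v`. This is
-- what allows the square function to be regrouped by parent.
theorem erase_ancestors {p v : V} (hp : p ∈ ancestors hG ρ v) (h : G.dist p v = 1) :
    (ancestors hG ρ v).erase v = ancestors hG ρ p := by
  have hd := dist_root_eq_add hp
  ext u
  rw [Finset.mem_erase]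
  constructor
  · rintro ⟨huv, hu⟩
    rcases mem_ancestors_or hu hp with h' | h'
    · exact h'
    · have h1 := dist_root_eq_add h'
      have h2 := dist_root_eq_add hu
      have h3 := hG.connected.pos_dist_of_ne huv
      rw [eq_of_dist_root_le h' (by omega)]
      exact self_mem_ancestors hG ρ u
  · intro hu
    refine ⟨?_, ancestors_subset hp hu⟩
    rintro rfl
    have := dist_root_eq_add hu
    omega

theorem parent_unique {p p' v : V} (hp : p ∈ ancestors hG ρ v) (h : G.dist p v = 1)
    (hp' : p' ∈ ancestors hG ρ v) (h' : G.dist p' v = 1) : p = p' := by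
  have e := (erase_ancestors hp h).symm.trans (erase_ancestors hp' h')
  refine eq_of_mem_ancestors (hG := hG) (ρ := ρ) ?_ ?_
  · rw [← e]; exact self_mem_ancestors hG ρ p
  · rw [e]; exact self_mem_ancestors hG ρ p'

theorem card_ancestors_sdiff [DecidableEq V] {x v : V} (h : x ∈ ancestors hG ρ v) :
    (ancestors hG ρ v \ ancestors hG ρ x).card = G.dist x v := by
  have h1 := Finset.card_sdiff_add_card_eq_card (ancestors_subset h)
  have h2 := dist_root_eq_add h
  rw [card_ancestors, card_ancestors] at h1
  omega

theorem mem_ancestors_root {u : V} : u ∈ ancestors hG ρ ρ ↔ u = ρ := by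
  refine ⟨fun h => eq_of_dist_root_le h (by simp), ?_⟩
  rintro rfl
  exact self_mem_ancestors hG u u

theorem exists_lowerSet_superset [DecidableEq V] (F : Finset V) :
    ∃ S : Finset V, ρ ∈ S ∧ F ⊆ S ∧ ∀ v ∈ S, ancestors hG ρ v ⊆ S := by
  refine ⟨insert ρ (F.biUnion (ancestors hG ρ)), Finset.mem_insert_self _ _, ?_, ?_⟩
  · intro v hv
    exact Finset.mem_insert_of_mem (Finset.mem_biUnion.2 ⟨v, hv, self_mem_ancestors hG ρ v⟩)
  · intro v hv u hu
    rcases Finset.mem_insert.1 hv with rfl | hv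
    · rw [mem_ancestors_root] at hu
      rw [hu]; exact Finset.mem_insert_self _ _
    · obtain ⟨w, hw, hvw⟩ := Finset.mem_biUnion.1 hv
      exact Finset.mem_insert_of_mem (Finset.mem_biUnion.2 ⟨w, hw, ancestors_subset hvw hu⟩)

/-- Induction over the finite sub-trees containing the root, one leaf at a time. -/
theorem lowerSet_induction [DecidableEq V] {motive : Finset V → Prop} (root : motive {ρ})
    (step : ∀ (S : Finset V) (x : V), ρ ∈ S → (∀ v ∈ S, ancestors hG ρ v ⊆ S) → x ∉ S →
      (ancestors hG ρ x).erase x ⊆ S → motive S → motive (insert x S))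
    (S : Finset V) (hρ : ρ ∈ S) (hS : ∀ v ∈ S, ancestors hG ρ v ⊆ S) : motive S := by
  induction hn : S.card generalizing S with
  | zero => simp_all
  | succ n ih =>
    by_cases h1 : S = {ρ}
    · rwa [h1]
    -- A vertex of maximal depth has no strict descendant in `S`, so erasing it keeps the set closed
    -- under ancestors.
    · obtain ⟨x, hx, hmax⟩ := S.exists_max_image (G.dist ρ) ⟨ρ, hρ⟩
      have hxρ : x ≠ ρ := by
        rintro rfl
        refine h1 (Finset.eq_singleton_iff_unique_mem.2 ⟨hρ, fun y hy => ?_⟩)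
        have := hmax y hy
        rw [SimpleGraph.dist_self] at this
        exact (hG.connected.dist_eq_zero_iff.1 (by omega)).symm
      have hρ' : ρ ∈ S.erase x := Finset.mem_erase.2 ⟨hxρ.symm, hρ⟩
      have hS' : ∀ v ∈ S.erase x, ancestors hG ρ v ⊆ S.erase x := by
        intro v hv u hu
        rw [Finset.mem_erase] at hv ⊢
        refine ⟨?_, hS v hv.2 hu⟩
        rintro rfl
        exact hv.1 (eq_of_dist_root_le hu (hmax v hv.2)).symm
      rw [← Finset.insert_erase hx]
      refine step _ x hρ' hS' (Finset.notMem_erase _ _) ?_ (ih _ hρ' hS' ?_)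
      · exact Finset.erase_subset_erase _ (hS x hx)
      · rw [Finset.card_erase_of_mem hx, hn]; rfl

end Tree

/-! ### Convexity and Taylor inequalities for real powers -/

section RealInequalities

/-- Bernoulli's inequality, rescaled by `y`. -/
theorem rpow_add_le_tangent {p x y : ℝ} (hp : 1 ≤ p) (hx : 0 ≤ x) (hy : 0 ≤ y) :
    y ^ p + p * y ^ (p - 1) * (x - y) ≤ x ^ p := by
  rcases hy.eq_or_lt with rfl | hy
  · rcases hp.eq_or_lt with rfl | hp
    · simp
    · rw [Real.zero_rpow (by linarith), Real.zero_rpow (by linarith)]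
      simpa using Real.rpow_nonneg hx p
  · have h := one_add_mul_self_le_rpow_one_add (s := x / y - 1)
      (by linarith [div_nonneg hx hy.le]) hp
    have e : x ^ p = y ^ p * (1 + (x / y - 1)) ^ p := by
      rw [← Real.mul_rpow hy.le (by linarith [div_nonneg hx hy.le])]
      congr 1; field_simp; ring
    have e2 : y ^ (p - 1) * y = y ^ p := by
      rw [← Real.rpow_add_one hy.ne']; congr 1; ring
    rw [e]
    refine le_trans (le_of_eq ?_) (mul_le_mul_of_nonneg_left h (Real.rpow_nonneg hy.le p))
    rw [← e2]
    field_simp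

theorem one_add_rpow_le_taylor {q t : ℝ} (hq : 2 ≤ q) (ht : -1 ≤ t) :
    (1 + t) ^ q ≤ 1 + q * t + 2 ^ q * q ^ 2 * (t ^ 2 + |t| ^ q) := by
  have h2 : (1 : ℝ) ≤ 2 ^ q := Real.one_le_rpow (by norm_num) (by linarith)
  have ht0 : 0 ≤ |t| ^ q := Real.rpow_nonneg (abs_nonneg t) q
  have hK : q * q ≤ 2 ^ q * q ^ 2 := by nlinarith
  rcases le_total t 1 with h1 | h1
  -- The tangent at `1 + t`, evaluated at `1`, gives `(1 + t)^q ≤ 1 + q t (1 + t)^(q-1)`, so only `t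
  -- ((1 + t)^(q-1) - 1)` remains to be compared with `t ^ 2`.
  · have hA := rpow_add_le_tangent (p := q) (x := 1) (y := 1 + t) (by linarith) zero_le_one
      (by linarith)
    rw [Real.one_rpow] at hA
    have key : t * ((1 + t) ^ (q - 1) - 1) ≤ 2 ^ q * q * t ^ 2 := by
      rcases le_total t 0 with h0 | h0
      · have := one_add_mul_self_le_rpow_one_add (s := t) ht (p := q - 1) (by linarith)
        have h3 : (q - 1) * t * t ≤ 2 ^ q * q * t ^ 2 := by
          nlinarith [sq_nonneg t, mul_nonneg (sub_nonneg.2 h2) (mul_nonneg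
            (by linarith : (0:ℝ) ≤ q) (sq_nonneg t))]
        nlinarith
      · have hB := rpow_add_le_tangent (p := q - 1) (x := 1) (y := 1 + t) (by linarith)
          zero_le_one (by linarith)
        rw [Real.one_rpow] at hB
        have h5 : (1 + t) ^ (q - 1 - 1) ≤ 2 ^ q :=
          (Real.rpow_le_rpow (by linarith) (by linarith : 1 + t ≤ 2) (by linarith)).trans
            (Real.rpow_le_rpow_of_exponent_le (by norm_num) (by linarith))
        have h6 : (1 + t) ^ (q - 1) - 1 ≤ (q - 1) * (1 + t) ^ (q - 1 - 1) * t := by linarith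
        have h7 : (q - 1) * (1 + t) ^ (q - 1 - 1) * t ≤ q * 2 ^ q * t := by
          gcongr
          linarith
        calc t * ((1 + t) ^ (q - 1) - 1) ≤ t * (q * 2 ^ q * t) := by
              gcongr; exact h6.trans h7
          _ = _ := by ring
    have h8 : q * (t * ((1 + t) ^ (q - 1) - 1)) ≤ q * (2 ^ q * q * t ^ 2) := by gcongr
    have h9 : 0 ≤ 2 ^ q * q ^ 2 * |t| ^ q := by positivity
    nlinarith
  · have h3 : (1 + t) ^ q ≤ (2 * t) ^ q :=
      Real.rpow_le_rpow (by linarith) (by linarith) (by linarith)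
    rw [Real.mul_rpow (by norm_num) (by linarith)] at h3
    rw [abs_of_nonneg (by linarith : (0:ℝ) ≤ t)] at *
    have h4 : 2 ^ q * t ^ q ≤ 2 ^ q * q ^ 2 * t ^ q := by
      have : (2 : ℝ) ^ q ≤ 2 ^ q * q ^ 2 := le_mul_of_one_le_right (by linarith) (by nlinarith)
      gcongr
    have : 0 ≤ 2 ^ q * q ^ 2 * t ^ 2 := by positivity
    nlinarith

/-- The first-order term is kept exact because it has mean zero when `t` is a centred increment; the
remainder produces the variance and the `q`-th central moment. -/
theorem add_rpow_le_taylor {q a t : ℝ} (hq : 2 ≤ q) (ha : 0 ≤ a) (hat : 0 ≤ a + t) :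
    (a + t) ^ q ≤
      a ^ q + q * a ^ (q - 1) * t + 2 ^ q * q ^ 2 * (a ^ (q - 2) * t ^ 2 + |t| ^ q) := by
  have h2 : (1 : ℝ) ≤ 2 ^ q := Real.one_le_rpow (by norm_num) (by linarith)
  rcases ha.eq_or_lt with rfl | ha
  · rw [zero_add] at *
    rw [Real.zero_rpow (by linarith : q ≠ 0), Real.zero_rpow (by linarith : q - 1 ≠ 0),
      abs_of_nonneg hat]
    have h3 : (1 : ℝ) ≤ 2 ^ q * q ^ 2 := by nlinarith
    have h4 : 0 ≤ (0 : ℝ) ^ (q - 2) * t ^ 2 :=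
      mul_nonneg (Real.rpow_nonneg le_rfl _) (sq_nonneg _)
    have h5 : 0 ≤ t ^ q := Real.rpow_nonneg hat q
    nlinarith
  · have hs : -1 ≤ t / a := by rw [le_div_iff₀ ha]; linarith
    have h := one_add_rpow_le_taylor hq hs
    have e : (a + t) ^ q = a ^ q * (1 + t / a) ^ q := by
      rw [← Real.mul_rpow ha.le (by linarith)]; congr 1; field_simp
    have e1 : a ^ (q - 1) * a = a ^ q := by
      rw [← Real.rpow_add_one ha.ne']; congr 1; ring
    have e2 : a ^ (q - 2) * a ^ 2 = a ^ q := by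
      rw [← Real.rpow_natCast, ← Real.rpow_add ha]; congr 1; norm_num
    have e3 : a ^ q * |t / a| ^ q = |t| ^ q := by
      rw [← Real.mul_rpow ha.le (abs_nonneg _), abs_div, abs_of_pos ha]; congr 1; field_simp
    have e4 : a ^ q * (t / a) = a ^ (q - 1) * t := by rw [← e1]; field_simp
    have e5 : a ^ q * (t / a) ^ 2 = a ^ (q - 2) * t ^ 2 := by rw [← e2]; field_simp
    rw [e]
    refine (mul_le_mul_of_nonneg_left h (Real.rpow_nonneg ha.le q)).trans (le_of_eq ?_)
    rw [← e3, ← e5, mul_assoc q, ← e4]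
    ring

/-- With `x = M` and `u ^ 2`, `y ^ 2` the old and new square functions, this makes the second-order
terms telescope. If `y ≤ x`, then `y^2 - u^2 ≤ 2 x (y - u)`; otherwise `x^(q-2) (y^2 - u^2) ≤ y^q -
u^q`. -/
theorem rpow_mul_sq_sub_sq_le {q x u y : ℝ} (hq : 2 ≤ q) (hx : 0 ≤ x) (hu : 0 ≤ u)
    (huy : u ≤ y) :
    x ^ (q - 2) * (y ^ 2 - u ^ 2) + 2 * x ^ (q - 1) * u + u ^ q ≤ 2 * x ^ (q - 1) * y + y ^ q := by
  have hy : 0 ≤ y := hu.trans huy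
  have aux : ∀ z : ℝ, 0 ≤ z → z ^ (q - 2) * z ^ 2 = z ^ q := fun z hz => by
    rw [← Real.rpow_natCast, ← Real.rpow_add_of_nonneg hz (by linarith) (by norm_num)]
    congr 1; norm_num
  have aux1 : x ^ (q - 2) * x = x ^ (q - 1) := by
    conv_lhs => rw [← Real.rpow_one x, ← Real.rpow_mul hx, one_mul]
    rw [← Real.rpow_add_of_nonneg hx (by linarith) (by norm_num)]
    congr 1; ring
  have hx1 : 0 ≤ x ^ (q - 1) := Real.rpow_nonneg hx _
  have hx2 : 0 ≤ x ^ (q - 2) := Real.rpow_nonneg hx _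
  rcases le_total y x with h | h
  · have h3 : u ^ q ≤ y ^ q := Real.rpow_le_rpow hu huy (by linarith)
    have h4 : (y - u) * (y + u) ≤ (y - u) * (2 * x) :=
      mul_le_mul_of_nonneg_left (by linarith) (by linarith)
    have h5 := mul_le_mul_of_nonneg_left h4 hx2
    rw [← aux1]
    nlinarith
  · have h3 : x ^ (q - 2) ≤ y ^ (q - 2) := Real.rpow_le_rpow hx h (by linarith)
    have h4 : u ^ (q - 2) ≤ y ^ (q - 2) := Real.rpow_le_rpow hu huy (by linarith)
    have h5 : u ^ 2 ≤ y ^ 2 := by gcongr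
    have h6 := mul_le_mul_of_nonneg_right h3 (sub_nonneg.2 h5)
    have h7 := mul_le_mul_of_nonneg_right h4 (sq_nonneg u)
    have h8 := mul_le_mul_of_nonneg_left huy hx1
    rw [← aux u hu, ← aux y hy]
    nlinarith

end RealInequalities

/-! ### Extended non-negative versions, Young's inequality and absorption -/

section ENNRealInequalities

/-- Tangent at `a + d`, applied to the old square function and its increment; both are known before
the new vertex is revealed. -/
theorem ennreal_rpow_le_rpow_add_mul {r : ℝ} (hr : 1 ≤ r) {a d : ℝ≥0∞} (ha : a ≠ ∞) (hd : d ≠ ∞) :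
    (a + d) ^ r ≤ a ^ r + ENNReal.ofReal r * ((a + d) ^ (r - 1) * d) := by
  lift a to ℝ≥0 using ha
  lift d to ℝ≥0 using hd
  have h := rpow_add_le_tangent (p := r) (x := a) (y := a + d) hr a.2 (by positivity)
  have h' : ((a : ℝ) + d) ^ r ≤ (a : ℝ) ^ r + r * (((a : ℝ) + d) ^ (r - 1) * d) := by linarith
  have h'' : (a + d) ^ r ≤ a ^ r + r.toNNReal * ((a + d) ^ (r - 1) * d) := by
    rw [← NNReal.coe_le_coe]; push_cast
    rwa [Real.coe_toNNReal r (by linarith)]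
  rw [ENNReal.ofReal, ← ENNReal.coe_add, ← ENNReal.coe_rpow_of_nonneg _ (by linarith),
    ← ENNReal.coe_rpow_of_nonneg _ (by linarith), ← ENNReal.coe_rpow_of_nonneg _ (by linarith)]
  exact_mod_cast h''

theorem ennreal_rpow_mul_sq_sub_sq_le {q : ℝ} (hq : 2 ≤ q) {x a d : ℝ≥0∞} (hx : x ≠ ∞)
    (ha : a ≠ ∞) (hd : d ≠ ∞) :
    x ^ (q - 2) * d + 2 * (x ^ (q - 1) * a ^ (1 / 2 : ℝ)) + a ^ (q / 2) ≤
      2 * (x ^ (q - 1) * (a + d) ^ (1 / 2 : ℝ)) + (a + d) ^ (q / 2) := by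
  lift a to ℝ≥0 using ha
  lift d to ℝ≥0 using hd
  lift x to ℝ≥0 using hx
  have h := rpow_mul_sq_sub_sq_le (x := x) (u := ((a : ℝ) ^ (1 / 2 : ℝ)))
    (y := (((a : ℝ) + d) ^ (1 / 2 : ℝ))) hq x.2 (by positivity)
    (Real.rpow_le_rpow a.2 (by simp) (by norm_num))
  have e1 : ∀ z : ℝ, 0 ≤ z → (z ^ (1 / 2 : ℝ)) ^ 2 = z := fun z hz => by
    rw [← Real.sqrt_eq_rpow, Real.sq_sqrt hz]
  have e2 : ∀ z : ℝ, 0 ≤ z → (z ^ (1 / 2 : ℝ)) ^ q = z ^ (q / 2) := fun z hz => by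
    rw [← Real.rpow_mul hz]; congr 1; ring
  rw [e1 _ a.coe_nonneg, e1 _ (by positivity), e2 _ a.coe_nonneg, e2 _ (by positivity),
    add_sub_cancel_left] at h
  have h'' : x ^ (q - 2) * d + 2 * (x ^ (q - 1) * a ^ (1 / 2 : ℝ)) + a ^ (q / 2) ≤
      2 * (x ^ (q - 1) * (a + d) ^ (1 / 2 : ℝ)) + (a + d) ^ (q / 2) := by
    rw [← NNReal.coe_le_coe]; push_cast; linarith
  rw [← ENNReal.coe_add]
  repeat rw [← ENNReal.coe_rpow_of_nonneg _ (by linarith)]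
  exact_mod_cast h''

theorem rpow_sub_one_mul_self {p : ℝ} (hp : 1 ≤ p) (z : ℝ≥0∞) : z ^ (p - 1) * z = z ^ p := by
  conv_lhs => rw [← ENNReal.rpow_one z, ← ENNReal.rpow_mul, one_mul]
  rw [← ENNReal.rpow_add_of_nonneg _ _ (by linarith) (by norm_num)]
  congr 1; ring

/-- Young's inequality by cases: either `2 K y ≤ x` and the first term suffices, or `x` may be
replaced by `2 K y`. The factor `1/2` is there for absorption. -/
theorem mul_rpow_sub_one_mul_le {p : ℝ} (hp : 1 ≤ p) {K x y : ℝ≥0∞} :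
    K * (x ^ (p - 1) * y) ≤ x ^ p / 2 + (2 * K) ^ p * y ^ p := by
  rcases le_total (2 * K * y) x with h | h
  · refine le_add_right ?_
    rw [ENNReal.le_div_iff_mul_le (by simp) (by simp), ← rpow_sub_one_mul_self hp]
    calc K * (x ^ (p - 1) * y) * 2 = x ^ (p - 1) * (2 * K * y) := by ring
      _ ≤ _ := by gcongr
  · refine le_add_left ?_
    rw [← ENNReal.mul_rpow_of_nonneg _ _ (by linarith)]
    calc K * (x ^ (p - 1) * y) ≤ K * ((2 * K * y) ^ (p - 1) * y) := by
          gcongr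
      _ = (2 * K * y) ^ (p - 1) * (1 * K * y) := by ring
      _ ≤ (2 * K * y) ^ (p - 1) * (2 * K * y) := by gcongr; norm_num
      _ = _ := rpow_sub_one_mul_self hp _

theorem ennreal_le_two_mul_of_le_half_add {x y : ℝ≥0∞} (hx : x ≠ ∞) (h : x ≤ x / 2 + y) :
    x ≤ 2 * y := by
  have h2 : x / 2 ≤ y := by
    have : x / 2 + x / 2 ≤ x / 2 + y := by rwa [ENNReal.add_halves]
    exact (ENNReal.add_le_add_iff_left (ENNReal.div_ne_top hx (by simp))).1 this
  rw [ENNReal.div_le_iff_le_mul (by simp) (by simp)] at h2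
  rwa [mul_comm]

end ENNRealInequalities

/-! ### Moments of an affine function of one random variable -/

section OneVariable

variable {Ω : Type*} [MeasurableSpace Ω] {P : Measure Ω} {X : Ω → ℝ} {q : ℝ}

theorem memLp_of_integrable_rpow (hq : 0 < q) (hm : AEMeasurable X P) (h0 : ∀ᵐ ω ∂P, 0 ≤ X ω)
    (hi : Integrable (fun ω => X ω ^ q) P) : MemLp X (ENNReal.ofReal q) P := by
  rw [← integrable_norm_rpow_iff hm.aestronglyMeasurable (by simpa using hq) (by simp),
    ENNReal.toReal_ofReal hq.le]
  refine hi.congr ?_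
  filter_upwards [h0] with ω hω
  rw [Real.norm_of_nonneg hω]

theorem const_add_mul_ofReal_ae (h0 : ∀ᵐ ω ∂P, 0 ≤ X ω) (c b : ℝ≥0) :
    (fun ω => (c : ℝ≥0∞) + b * ENNReal.ofReal (X ω)) =ᵐ[P]
      fun ω => ENNReal.ofReal (c + b * X ω) := by
  filter_upwards [h0] with ω hω
  rw [ENNReal.ofReal_add c.coe_nonneg (by positivity), ENNReal.ofReal_mul b.coe_nonneg, ENNReal.ofReal_coe_nnreal,
    ENNReal.ofReal_coe_nnreal]

variable [IsProbabilityMeasure P]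

theorem rpow_lintegral_le_lintegral_rpow {f : Ω → ℝ≥0∞} (hf : AEMeasurable f P) {p : ℝ}
    (hp : 1 ≤ p) : (∫⁻ ω, f ω ∂P) ^ p ≤ ∫⁻ ω, f ω ^ p ∂P := by
  have h := eLpNorm'_le_eLpNorm'_of_exponent_le (μ := P) (f := f) zero_lt_one hp
    hf.aestronglyMeasurable
  simp only [eLpNorm', enorm_eq_self, ENNReal.rpow_one, div_one] at h
  calc (∫⁻ ω, f ω ∂P) ^ p ≤ ((∫⁻ ω, f ω ^ p ∂P) ^ (1 / p)) ^ p := by gcongr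
    _ = _ := by
      rw [← ENNReal.rpow_mul, one_div, inv_mul_cancel₀ (by linarith), ENNReal.rpow_one]

theorem memLp_two_of_two_le (hq : 2 ≤ q) (hX : MemLp X (ENNReal.ofReal q) P) : MemLp X 2 P :=
  hX.mono_exponent (by rw [← ENNReal.ofReal_ofNat]; exact ENNReal.ofReal_le_ofReal hq)

theorem lintegral_const_add_mul (hX : MemLp X 2 P) (h0 : ∀ᵐ ω ∂P, 0 ≤ X ω) (c b : ℝ≥0∞) :
    ∫⁻ ω, (c + b * ENNReal.ofReal (X ω)) ∂P = c + b * ENNReal.ofReal (∫ ω, X ω ∂P) := by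
  have hm := hX.aestronglyMeasurable.aemeasurable
  rw [lintegral_add_left measurable_const, lintegral_const_mul'' _ hm.ennreal_ofReal,
    ofReal_integral_eq_lintegral_ofReal (hX.integrable (by norm_num)) h0]
  simp

theorem lintegral_sq_const_add_mul (hX : MemLp X 2 P) (h0 : ∀ᵐ ω ∂P, 0 ≤ X ω) {c b : ℝ≥0∞}
    (hc : c ≠ ∞) (hb : b ≠ ∞) :
    ∫⁻ ω, (c + b * ENNReal.ofReal (X ω)) ^ 2 ∂P =
      (c + b * ENNReal.ofReal (∫ ω, X ω ∂P)) ^ 2 + ENNReal.ofReal (variance X P) * b ^ 2 := by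
  lift c to ℝ≥0 using hc
  lift b to ℝ≥0 using hb
  have hm : 0 ≤ ∫ ω, X ω ∂P := integral_nonneg_of_ae h0
  have hZ : MemLp (fun ω => (c : ℝ) + b * X ω) 2 P :=
    (memLp_const (c : ℝ)).add (hX.const_mul (b : ℝ))
  have hv : variance (fun ω => (c : ℝ) + b * X ω) P = b ^ 2 * variance X P := by
    rw [variance_const_add (hX.const_mul (b : ℝ)).aestronglyMeasurable, variance_const_mul]
  have hE : ∫ ω, ((c : ℝ) + b * X ω) ∂P = c + b * ∫ ω, X ω ∂P := by
    rw [integral_add (integrable_const _) ((hX.integrable (by norm_num)).const_mul _),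
      integral_const_mul]
    simp
  rw [variance_eq_sub hZ, hE] at hv
  have hs : ∫ ω, ((c : ℝ) + b * X ω) ^ 2 ∂P
      = (c + b * ∫ ω, X ω ∂P) ^ 2 + variance X P * b ^ 2 := by
    have : P[(fun ω => (c : ℝ) + b * X ω) ^ 2] = ∫ ω, ((c : ℝ) + b * X ω) ^ 2 ∂P := rfl
    linarith
  have e : ∫⁻ ω, (c + b * ENNReal.ofReal (X ω)) ^ 2 ∂P
      = ∫⁻ ω, ENNReal.ofReal (((c : ℝ) + b * X ω) ^ 2) ∂P := by
    refine lintegral_congr_ae ?_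
    filter_upwards [h0, const_add_mul_ofReal_ae h0 c b] with ω h0 hω
    rw [hω, ENNReal.ofReal_pow (by positivity)]
  rw [e, ← ofReal_integral_eq_lintegral_ofReal hZ.integrable_sq
    (Filter.Eventually.of_forall fun ω => sq_nonneg _), hs,
    ENNReal.ofReal_add (by positivity) (mul_nonneg (variance_nonneg _ _) (by positivity)),
    ENNReal.ofReal_pow (by positivity), ENNReal.ofReal_mul (variance_nonneg _ _),
    ENNReal.ofReal_add c.coe_nonneg (by positivity), ENNReal.ofReal_mul b.coe_nonneg,
    ENNReal.ofReal_pow b.coe_nonneg, ENNReal.ofReal_coe_nnreal, ENNReal.ofReal_coe_nnreal]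

theorem rpow_le_lintegral_const_add_mul (hX : MemLp X 2 P) (h0 : ∀ᵐ ω ∂P, 0 ≤ X ω)
    {p : ℝ} (hp : 1 ≤ p) (c b : ℝ≥0∞) :
    (c + b * ENNReal.ofReal (∫ ω, X ω ∂P)) ^ p ≤
      ∫⁻ ω, (c + b * ENNReal.ofReal (X ω)) ^ p ∂P := by
  rw [← lintegral_const_add_mul hX h0]
  refine rpow_lintegral_le_lintegral_rpow ?_ hp
  exact (hX.aestronglyMeasurable.aemeasurable.ennreal_ofReal.const_mul b).const_add c

/-- Integrate `add_rpow_le_taylor` with base point `a = c + b E[X]` and increment `b (X - E[X])`;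
the linear term vanishes. -/
theorem lintegral_rpow_const_add_mul_le (hq : 2 ≤ q) (hX : MemLp X (ENNReal.ofReal q) P)
    (h0 : ∀ᵐ ω ∂P, 0 ≤ X ω) {c b : ℝ≥0∞} (hc : c ≠ ∞) (hb : b ≠ ∞) :
    ∫⁻ ω, (c + b * ENNReal.ofReal (X ω)) ^ q ∂P ≤
      (c + b * ENNReal.ofReal (∫ ω, X ω ∂P)) ^ q + ENNReal.ofReal (2 ^ q * q ^ 2) *
        ((c + b * ENNReal.ofReal (∫ ω, X ω ∂P)) ^ (q - 2) * (ENNReal.ofReal (variance X P) * b ^ 2)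
          + (∫⁻ ω, ‖X ω - ∫ ω', X ω' ∂P‖ₑ ^ q ∂P) * b ^ q) := by
  lift c to ℝ≥0 using hc
  lift b to ℝ≥0 using hb
  have hX2 : MemLp X 2 P := memLp_two_of_two_le hq hX
  have hX1 : Integrable X P := hX2.integrable (by norm_num)
  set m := ∫ ω, X ω ∂P with hm_def
  have hm : 0 ≤ m := integral_nonneg_of_ae h0
  have hcen : MemLp (fun ω => X ω - m) (ENNReal.ofReal q) P := hX.sub (memLp_const m)
  have hint : Integrable (fun ω => |X ω - m| ^ q) P := by
    have := hcen.integrable_norm_rpow (by simp; linarith) (by simp)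
    rwa [ENNReal.toReal_ofReal (by linarith)] at this
  have hint2 : Integrable (fun ω => (X ω - m) ^ 2) P := (hX2.sub (memLp_const m)).integrable_sq
  have hv : ∫ ω, (X ω - m) ^ 2 ∂P = variance X P :=
    (variance_eq_integral hX1.aestronglyMeasurable.aemeasurable).symm
  set a : ℝ := c + b * m with ha
  have ha0 : 0 ≤ a := by positivity
  set K : ℝ := 2 ^ q * q ^ 2 with hK
  have hK0 : 0 ≤ K := by positivity
  have i1 : Integrable (fun ω => a ^ q + q * a ^ (q - 1) * (b * (X ω - m))) P :=
    (integrable_const _).add (((hX1.sub (integrable_const m)).const_mul _).const_mul _)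
  have i2 : Integrable (fun ω => a ^ (q - 2) * (b * (X ω - m)) ^ 2) P := by
    simp_rw [mul_pow]; exact (hint2.const_mul _).const_mul _
  have i3 : Integrable (fun ω => |b * (X ω - m)| ^ q) P := by
    simp_rw [abs_mul, Real.mul_rpow (abs_nonneg _) (abs_nonneg _)]; exact hint.const_mul _
  have i23 : Integrable (fun ω => K * (a ^ (q - 2) * (b * (X ω - m)) ^ 2 +
      |b * (X ω - m)| ^ q)) P := (i2.add i3).const_mul K
  have i123 : Integrable (fun ω => (a ^ q + q * a ^ (q - 1) * (b * (X ω - m))) +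
      K * (a ^ (q - 2) * (b * (X ω - m)) ^ 2 + |b * (X ω - m)| ^ q)) P := i1.add i23
  have hle : ∫⁻ ω, (c + b * ENNReal.ofReal (X ω)) ^ q ∂P ≤
      ∫⁻ ω, ENNReal.ofReal ((a ^ q + q * a ^ (q - 1) * (b * (X ω - m))) +
        K * (a ^ (q - 2) * (b * (X ω - m)) ^ 2 + |b * (X ω - m)| ^ q)) ∂P := by
    refine lintegral_mono_ae ?_
    filter_upwards [h0, const_add_mul_ofReal_ae h0 c b] with ω hω h
    rw [h, ENNReal.ofReal_rpow_of_nonneg (by positivity) (by linarith)]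
    refine ENNReal.ofReal_le_ofReal ?_
    have e : (c : ℝ) + b * X ω = a + b * (X ω - m) := by rw [ha]; ring
    rw [e]
    exact add_rpow_le_taylor hq ha0 (by rw [← e]; positivity)
  have hval : ∫ ω, ((a ^ q + q * a ^ (q - 1) * (b * (X ω - m))) +
        K * (a ^ (q - 2) * (b * (X ω - m)) ^ 2 + |b * (X ω - m)| ^ q)) ∂P
      = a ^ q + K * (a ^ (q - 2) * (variance X P * b ^ 2) + (∫ ω, |X ω - m| ^ q ∂P) * b ^ q) := by
    have j1 : ∫ ω, (a ^ q + q * a ^ (q - 1) * (b * (X ω - m))) ∂P = a ^ q := by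
      have i4 : Integrable (fun ω => X ω - m) P := hX1.sub (integrable_const m)
      rw [integral_add (integrable_const _) ((i4.const_mul _).const_mul _), integral_const_mul,
        integral_const_mul, integral_sub hX1 (integrable_const m)]
      simp [← hm_def]
    have j2 : ∫ ω, a ^ (q - 2) * (b * (X ω - m)) ^ 2 ∂P = a ^ (q - 2) * (variance X P * b ^ 2) := by
      simp_rw [mul_pow]
      rw [integral_const_mul, integral_const_mul, hv, mul_comm (variance X P)]
    have j3 : ∫ ω, |b * (X ω - m)| ^ q ∂P = (∫ ω, |X ω - m| ^ q ∂P) * b ^ q := by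
      simp_rw [abs_mul, Real.mul_rpow (abs_nonneg _) (abs_nonneg _)]
      rw [integral_const_mul, NNReal.abs_eq, mul_comm]
    rw [integral_add i1 i23, j1, integral_const_mul, integral_add i2 i3, j2, j3]
  have hnn : 0 ≤ᵐ[P] fun ω => (a ^ q + q * a ^ (q - 1) * (b * (X ω - m))) +
        K * (a ^ (q - 2) * (b * (X ω - m)) ^ 2 + |b * (X ω - m)| ^ q) := by
    filter_upwards [h0] with ω hω
    have e : (c : ℝ) + b * X ω = a + b * (X ω - m) := by rw [ha]; ring
    have h1 : 0 ≤ a + b * (X ω - m) := by rw [← e]; positivity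
    exact (Real.rpow_nonneg h1 q).trans (add_rpow_le_taylor hq ha0 h1)
  have hk : ∫⁻ ω, ‖X ω - m‖ₑ ^ q ∂P = ENNReal.ofReal (∫ ω, |X ω - m| ^ q ∂P) := by
    rw [ofReal_integral_eq_lintegral_ofReal hint
      (Filter.Eventually.of_forall fun ω => Real.rpow_nonneg (abs_nonneg _) _)]
    refine lintegral_congr fun ω => ?_
    rw [Real.enorm_eq_ofReal_abs, ENNReal.ofReal_rpow_of_nonneg (abs_nonneg _) (by linarith)]
  have hκ0 : 0 ≤ ∫ ω, |X ω - m| ^ q ∂P :=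
    integral_nonneg fun ω => Real.rpow_nonneg (abs_nonneg _) _
  have hv0 := variance_nonneg X P
  refine hle.trans (le_of_eq ?_)
  have hea : (c : ℝ≥0∞) + b * ENNReal.ofReal m = ENNReal.ofReal a := by
    rw [ha, ENNReal.ofReal_add c.coe_nonneg (by positivity), ENNReal.ofReal_mul b.coe_nonneg,
      ENNReal.ofReal_coe_nnreal, ENNReal.ofReal_coe_nnreal]
  rw [← ofReal_integral_eq_lintegral_ofReal i123 hnn, hval, hk, hea,
    ENNReal.ofReal_rpow_of_nonneg ha0 (by linarith),
    ENNReal.ofReal_rpow_of_nonneg ha0 (by linarith)]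
  have eb : (b : ℝ≥0∞) = ENNReal.ofReal b := (ENNReal.ofReal_coe_nnreal).symm
  rw [eb, ENNReal.ofReal_rpow_of_nonneg b.coe_nonneg (by linarith), ← ENNReal.ofReal_pow b.coe_nonneg,
    ← ENNReal.ofReal_mul hv0, ← ENNReal.ofReal_mul hκ0, ← ENNReal.ofReal_mul (by positivity),
    ← ENNReal.ofReal_add (by positivity) (by positivity), ← ENNReal.ofReal_mul hK0,
    ← ENNReal.ofReal_add (by positivity) (by positivity)]

/-- Jensen with exponent `q/2 ≥ 1`. It yields `κ ≥ 1`, so that additive constants can be absorbed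
into multiples of `κ`. -/
theorem variance_rpow_le (hq : 2 ≤ q) (hX : MemLp X (ENNReal.ofReal q) P) :
    ENNReal.ofReal (variance X P) ^ (q / 2) ≤ ∫⁻ ω, ‖X ω - ∫ ω', X ω' ∂P‖ₑ ^ q ∂P := by
  have hX2 : MemLp X 2 P := memLp_two_of_two_le hq hX
  have hm : AEMeasurable X P := hX.aestronglyMeasurable.aemeasurable
  rw [ofReal_variance hX2, evariance]
  refine (rpow_lintegral_le_lintegral_rpow ((hm.sub_const _).enorm.pow_const 2)
    (by linarith : 1 ≤ q / 2)).trans (le_of_eq (lintegral_congr fun ω => ?_))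
  rw [← ENNReal.rpow_natCast, ← ENNReal.rpow_mul]
  congr 1
  push_cast
  ring

end OneVariable

/-! ### One step of the martingale: revealing a single vertex -/

section Step

variable {Ω : Type*} {ℱ mΩ : MeasurableSpace Ω} {P : Measure Ω} [IsProbabilityMeasure P]

/-- Fubini for the product law of `(Z, C, B)` and `Y`; this takes the place of conditioning on `ℱ`.
-/
theorem lintegral_mul_rpow_of_indep (hℱ : ℱ ≤ mΩ) {Z C B Y : Ω → ℝ≥0∞}
    (hZ : Measurable[ℱ] Z) (hC : Measurable[ℱ] C) (hB : Measurable[ℱ] B) (hY : Measurable Y)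
    (hind : Indep ℱ (MeasurableSpace.comap Y inferInstance) P) (p : ℝ) :
    ∫⁻ ω, Z ω * (C ω + B ω * Y ω) ^ p ∂P =
      ∫⁻ ω, Z ω * ∫⁻ ω', (C ω + B ω * Y ω') ^ p ∂P ∂P := by
  have hT : Measurable[ℱ] fun ω => (Z ω, C ω, B ω) := hZ.prodMk (hC.prodMk hB)
  have hT' : Measurable fun ω => (Z ω, C ω, B ω) := hT.mono hℱ le_rfl
  have hI : IndepFun (fun ω => (Z ω, C ω, B ω)) Y P :=
    indep_of_indep_of_le_left hind hT.comap_le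
  rw [indepFun_iff_map_prod_eq_prod_map_map hT'.aemeasurable hY.aemeasurable] at hI
  have hf : Measurable fun z : (ℝ≥0∞ × ℝ≥0∞ × ℝ≥0∞) × ℝ≥0∞ =>
      z.1.1 * (z.1.2.1 + z.1.2.2 * z.2) ^ p := by fun_prop
  calc ∫⁻ ω, Z ω * (C ω + B ω * Y ω) ^ p ∂P
      = ∫⁻ z, z.1.1 * (z.1.2.1 + z.1.2.2 * z.2) ^ p
          ∂(P.map fun ω => ((Z ω, C ω, B ω), Y ω)) := by
        rw [lintegral_map hf (hT'.prodMk hY)]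
    _ = ∫⁻ ω, ∫⁻ ω', Z ω * (C ω + B ω * Y ω') ^ p ∂P ∂P := by
        rw [hI, lintegral_prod _ hf.aemeasurable, lintegral_map hf.lintegral_prod_right' hT']
        refine lintegral_congr fun ω => ?_
        exact lintegral_map (hf.comp (measurable_prodMk_left (x := (Z ω, C ω, B ω)))) hY
    _ = _ := by
        refine lintegral_congr fun ω => ?_
        rw [lintegral_const_mul _ (by fun_prop)]

variable {C B A Y : Ω → ℝ≥0∞} {m s : ℝ≥0∞}

/-- The martingale passes from `C + B m` to `C + B Y` and the square function from `A` to `A + D`,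
with `D = s B^2`. The conditional second moment of the new value is the old square plus `D`, which
is exactly the tangent term created by `A → A + D`. -/
theorem lintegral_bracket_rpow_le_step (hℱ : ℱ ≤ mΩ) (hC : Measurable[ℱ] C) (hB : Measurable[ℱ] B)
    (hA : Measurable[ℱ] A) (hY : Measurable Y)
    (hind : Indep ℱ (MeasurableSpace.comap Y inferInstance) P)
    (hCf : ∀ ω, C ω ≠ ∞) (hBf : ∀ ω, B ω ≠ ∞) (hAf : ∀ ω, A ω ≠ ∞) (hs : s ≠ ∞)
    (hsq : ∀ c b : ℝ≥0∞, c ≠ ∞ → b ≠ ∞ →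
      ∫⁻ ω, (c + b * Y ω) ^ 2 ∂P = (c + b * m) ^ 2 + s * b ^ 2)
    {r : ℝ} (hr : 1 ≤ r)
    (ih : ∫⁻ ω, A ω ^ r ∂P ≤
      ENNReal.ofReal r * ∫⁻ ω, A ω ^ (r - 1) * (C ω + B ω * m) ^ 2 ∂P) :
    ∫⁻ ω, (A ω + s * B ω ^ 2) ^ r ∂P ≤ ENNReal.ofReal r *
      ∫⁻ ω, (A ω + s * B ω ^ 2) ^ (r - 1) * (C ω + B ω * Y ω) ^ 2 ∂P := by
  have hC' := hC.mono hℱ le_rfl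
  have hB' := hB.mono hℱ le_rfl
  have hA' := hA.mono hℱ le_rfl
  have hDf : ∀ ω, s * B ω ^ 2 ≠ ∞ := fun ω => ENNReal.mul_ne_top hs (ENNReal.pow_ne_top (hBf ω))
  calc ∫⁻ ω, (A ω + s * B ω ^ 2) ^ r ∂P
      ≤ ∫⁻ ω, (A ω ^ r +
          ENNReal.ofReal r * ((A ω + s * B ω ^ 2) ^ (r - 1) * (s * B ω ^ 2))) ∂P :=
        lintegral_mono fun ω => ennreal_rpow_le_rpow_add_mul hr (hAf ω) (hDf ω)
    _ = ∫⁻ ω, A ω ^ r ∂P +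
          ENNReal.ofReal r * ∫⁻ ω, (A ω + s * B ω ^ 2) ^ (r - 1) * (s * B ω ^ 2) ∂P := by
        rw [lintegral_add_left (by fun_prop), lintegral_const_mul _ (by fun_prop)]
    _ ≤ ENNReal.ofReal r * ∫⁻ ω, (A ω + s * B ω ^ 2) ^ (r - 1) * (C ω + B ω * m) ^ 2 ∂P +
          ENNReal.ofReal r * ∫⁻ ω, (A ω + s * B ω ^ 2) ^ (r - 1) * (s * B ω ^ 2) ∂P := by
        gcongr
        refine ih.trans ?_
        gcongr with ω
        exact le_self_add
    _ = ENNReal.ofReal r * ∫⁻ ω, (A ω + s * B ω ^ 2) ^ (r - 1) *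
          ∫⁻ ω', (C ω + B ω * Y ω') ^ (2 : ℝ) ∂P ∂P := by
        rw [← mul_add, ← lintegral_add_left (by fun_prop)]
        congr 1
        refine lintegral_congr fun ω => ?_
        simp_rw [ENNReal.rpow_two]
        rw [hsq _ _ (hCf ω) (hBf ω), mul_add]
    _ = _ := by
        rw [← lintegral_mul_rpow_of_indep hℱ _ hC hB hY hind]
        · simp_rw [ENNReal.rpow_two]
        · exact (hA.add ((hB.pow_const 2).const_mul s)).pow_const _

/-- The mixed term carries `M^(q-1) A^(1/2)` rather than `M^(q-2) A` because Jensen makes `M^(q-1)`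
a submartingale for every `q ≥ 2`, while `q - 2` may be less than `1`. -/
theorem lintegral_rpow_le_step (hℱ : ℱ ≤ mΩ) (hC : Measurable[ℱ] C) (hB : Measurable[ℱ] B)
    (hA : Measurable[ℱ] A) (hY : Measurable Y)
    (hind : Indep ℱ (MeasurableSpace.comap Y inferInstance) P)
    (hCf : ∀ ω, C ω ≠ ∞) (hBf : ∀ ω, B ω ≠ ∞) (hAf : ∀ ω, A ω ≠ ∞) (hs : s ≠ ∞) (hm : m ≠ ∞)
    {q : ℝ} (hq : 2 ≤ q) {K κ : ℝ≥0∞}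
    (hlow : ∀ c b : ℝ≥0∞, (c + b * m) ^ (q - 1) ≤ ∫⁻ ω, (c + b * Y ω) ^ (q - 1) ∂P)
    (hup : ∀ c b : ℝ≥0∞, c ≠ ∞ → b ≠ ∞ → ∫⁻ ω, (c + b * Y ω) ^ q ∂P ≤
      (c + b * m) ^ q + K * ((c + b * m) ^ (q - 2) * (s * b ^ 2) + κ * (s * b ^ 2) ^ (q / 2)))
    (ih : ∫⁻ ω, (C ω + B ω * m) ^ q ∂P ≤
      2 * K * ∫⁻ ω, (C ω + B ω * m) ^ (q - 1) * A ω ^ (1 / 2 : ℝ) ∂P +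
        (1 + K + K * κ) * ∫⁻ ω, A ω ^ (q / 2) ∂P) :
    ∫⁻ ω, (C ω + B ω * Y ω) ^ q ∂P ≤
      2 * K * ∫⁻ ω, (C ω + B ω * Y ω) ^ (q - 1) * (A ω + s * B ω ^ 2) ^ (1 / 2 : ℝ) ∂P +
        (1 + K + K * κ) * ∫⁻ ω, (A ω + s * B ω ^ 2) ^ (q / 2) ∂P := by
  have hC' := hC.mono hℱ le_rfl
  have hB' := hB.mono hℱ le_rfl
  have hA' := hA.mono hℱ le_rfl
  have hDf : ∀ ω, s * B ω ^ 2 ≠ ∞ := fun ω => ENNReal.mul_ne_top hs (ENNReal.pow_ne_top (hBf ω))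
  have hMf : ∀ ω, C ω + B ω * m ≠ ∞ := fun ω =>
    ENNReal.add_ne_top.2 ⟨hCf ω, ENNReal.mul_ne_top (hBf ω) hm⟩
  have hexp := lintegral_mul_rpow_of_indep (P := P) hℱ (Z := fun _ => 1) measurable_const hC hB hY
    hind q
  simp only [one_mul] at hexp
  have hsub : ∫⁻ ω, (C ω + B ω * m) ^ (q - 1) * (A ω + s * B ω ^ 2) ^ (1 / 2 : ℝ) ∂P ≤
      ∫⁻ ω, (C ω + B ω * Y ω) ^ (q - 1) * (A ω + s * B ω ^ 2) ^ (1 / 2 : ℝ) ∂P := by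
    simp_rw [mul_comm _ ((A _ + s * B _ ^ 2) ^ (1 / 2 : ℝ))]
    rw [lintegral_mul_rpow_of_indep hℱ _ hC hB hY hind]
    · gcongr with ω
      exact hlow _ _
    · exact (hA.add ((hB.pow_const 2).const_mul s)).pow_const _
  calc ∫⁻ ω, (C ω + B ω * Y ω) ^ q ∂P
      = ∫⁻ ω, ∫⁻ ω', (C ω + B ω * Y ω') ^ q ∂P ∂P := hexp
    _ ≤ ∫⁻ ω, ((C ω + B ω * m) ^ q + K * ((C ω + B ω * m) ^ (q - 2) * (s * B ω ^ 2) +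
          κ * (s * B ω ^ 2) ^ (q / 2))) ∂P :=
        lintegral_mono fun ω => hup _ _ (hCf ω) (hBf ω)
    _ = ∫⁻ ω, (C ω + B ω * m) ^ q ∂P + ∫⁻ ω, K * ((C ω + B ω * m) ^ (q - 2) * (s * B ω ^ 2) +
          κ * (s * B ω ^ 2) ^ (q / 2)) ∂P := lintegral_add_left (by fun_prop) _
    _ ≤ _ := add_le_add_left ih _
    -- The coefficient `1 + K + K κ` is shared out: `K` feeds the telescoping inequality, `K κ` the
    -- superadditivity of `z^(q/2)`, and `1` only uses monotonicity in the square function.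
    _ = ∫⁻ ω, (K * ((C ω + B ω * m) ^ (q - 2) * (s * B ω ^ 2) +
          2 * ((C ω + B ω * m) ^ (q - 1) * A ω ^ (1 / 2 : ℝ)) + A ω ^ (q / 2)) +
          (A ω ^ (q / 2) + K * κ * (A ω ^ (q / 2) + (s * B ω ^ 2) ^ (q / 2)))) ∂P := by
        rw [← lintegral_const_mul _ (by fun_prop), ← lintegral_const_mul _ (by fun_prop),
          ← lintegral_add_left (by fun_prop), ← lintegral_add_left (by fun_prop)]
        refine lintegral_congr fun ω => ?_
        ring
    _ ≤ ∫⁻ ω, (2 * K * ((C ω + B ω * m) ^ (q - 1) * (A ω + s * B ω ^ 2) ^ (1 / 2 : ℝ)) +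
          (1 + K + K * κ) * (A ω + s * B ω ^ 2) ^ (q / 2)) ∂P := by
        refine lintegral_mono fun ω => ?_
        have h1 := ennreal_rpow_mul_sq_sub_sq_le hq (hMf ω) (hAf ω) (hDf ω)
        have h2 := ENNReal.add_rpow_le_rpow_add (A ω) (s * B ω ^ 2) (by linarith : 1 ≤ q / 2)
        have h3 : A ω ^ (q / 2) ≤ (A ω + s * B ω ^ 2) ^ (q / 2) :=
          ENNReal.rpow_le_rpow le_self_add (by linarith)
        refine (add_le_add (mul_le_mul_right h1 K)
          (add_le_add h3 (mul_le_mul_right h2 (K * κ)))).trans (le_of_eq ?_)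
        ring
    _ = 2 * K * ∫⁻ ω, (C ω + B ω * m) ^ (q - 1) * (A ω + s * B ω ^ 2) ^ (1 / 2 : ℝ) ∂P +
          (1 + K + K * κ) * ∫⁻ ω, (A ω + s * B ω ^ 2) ^ (q / 2) ∂P := by
        rw [lintegral_add_left (by fun_prop), lintegral_const_mul _ (by fun_prop),
          lintegral_const_mul _ (by fun_prop)]
    _ ≤ _ := by gcongr

end Step

/-! ### Algebra of the martingale decomposition for a fixed family of factors -/

section Deterministic

variable {V : Type*} {G : SimpleGraph V}

/-- The expected weighted sum over the sub-tree starting from `x`, normalised by `X(x) = 1`. -/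
noncomputable def meanSum (G : SimpleGraph V) (ρ : V) (α : V → ℝ≥0∞) (m : ℝ≥0∞) (x : V) : ℝ≥0∞ :=
  ∑' y : subtree G ρ x, α y * m ^ G.dist x (y : V)

/-- The weighted sum `∑_v α(v) ∏_{u ⪯ v} y(u)` of a deterministic family `y`. -/
noncomputable def weightedSum (hG : G.IsTree) (ρ : V) (α y : V → ℝ≥0∞) : ℝ≥0∞ :=
  ∑' v, α v * ∏ u ∈ ancestors hG ρ v, y u

open Classical in
/-- The weighted sum where the factors at the vertices outside `S` are averaged. -/
noncomputable def partialSum (hG : G.IsTree) (ρ : V) (α : V → ℝ≥0∞) (m : ℝ≥0∞) (S : Finset V)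
    (y : V → ℝ≥0∞) : ℝ≥0∞ :=
  weightedSum hG ρ α fun u => if u ∈ S then y u else m

open Classical in
/-- The part of `partialSum` coming from the vertices which are not in the sub-tree of `x`. -/
noncomputable def offSum (hG : G.IsTree) (ρ : V) (α : V → ℝ≥0∞) (m : ℝ≥0∞) (S : Finset V) (x : V)
    (y : V → ℝ≥0∞) : ℝ≥0∞ :=
  ∑' v, if x ∈ ancestors hG ρ v then 0 else
    α v * ∏ u ∈ ancestors hG ρ v, if u ∈ S then y u else m

open Classical in
/-- The coefficient of `X(x) - m` in the martingale decomposition of the weighted sum. -/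
noncomputable def coeff (hG : G.IsTree) (ρ : V) (α : V → ℝ≥0∞) (m : ℝ≥0∞) (x : V)
    (y : V → ℝ≥0∞) : ℝ≥0∞ :=
  (∏ u ∈ (ancestors hG ρ x).erase x, y u) * meanSum G ρ α m x

open Classical in
/-- The conditional square function of the martingale decomposition, up to the vertices in `S`. -/
noncomputable def partialBracket (hG : G.IsTree) (ρ : V) (α : V → ℝ≥0∞) (m s : ℝ≥0∞) (S : Finset V)
    (y : V → ℝ≥0∞) : ℝ≥0∞ :=
  meanSum G ρ α m ρ ^ 2 + s * ∑ x ∈ S, if x = ρ then 0 else coeff hG ρ α m x y ^ 2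

open Classical in
/-- The full conditional square function of the martingale decomposition. -/
noncomputable def bracket (hG : G.IsTree) (ρ : V) (α : V → ℝ≥0∞) (m s : ℝ≥0∞)
    (y : V → ℝ≥0∞) : ℝ≥0∞ :=
  meanSum G ρ α m ρ ^ 2 + s * ∑' x, if x = ρ then 0 else coeff hG ρ α m x y ^ 2

variable {hG : G.IsTree} {ρ : V} {α : V → ℝ≥0∞} {m s : ℝ≥0∞} {S : Finset V} {x : V}
  {y : V → ℝ≥0∞}

open Classical in
variable (hG) in
theorem meanSum_eq (x : V) : meanSum G ρ α m x =
    ∑' v, if x ∈ ancestors hG ρ v then α v * m ^ G.dist x v else 0 := by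
  rw [meanSum, tsum_subtype (subtree G ρ x) fun v => α v * m ^ G.dist x v]
  refine tsum_congr fun v => ?_
  simp only [Set.indicator_apply, subtree, Set.mem_ofPred_eq, mem_ancestors]

theorem prod_ancestors_const (v : V) (c : ℝ≥0∞) (hy1 : y ρ = 1) (hy : ∀ u, u ≠ ρ → y u = c) :
    ∏ u ∈ ancestors hG ρ v, y u = c ^ G.dist ρ v := by
  classical
  rw [← Finset.mul_prod_erase _ _ (root_mem_ancestors hG ρ v), hy1, one_mul,
    Finset.prod_congr rfl fun u hu => hy u (Finset.ne_of_mem_erase hu), Finset.prod_const,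
    Finset.card_erase_of_mem (root_mem_ancestors hG ρ v), card_ancestors, Nat.add_sub_cancel]

theorem weightedSum_const (c : ℝ≥0∞) (hy1 : y ρ = 1) (hy : ∀ u, u ≠ ρ → y u = c) :
    weightedSum hG ρ α y = meanSum G ρ α c ρ := by
  classical
  rw [weightedSum, meanSum_eq hG]
  refine tsum_congr fun v => ?_
  rw [if_pos (root_mem_ancestors hG ρ v), prod_ancestors_const v c hy1 hy]

theorem partialSum_root (hy1 : y ρ = 1) :
    partialSum hG ρ α m {ρ} y = meanSum G ρ α m ρ := by
  refine weightedSum_const m ?_ ?_ <;> simp +contextual [hy1]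

theorem partialSum_eq_of_support (hS : ∀ v ∈ S, ancestors hG ρ v ⊆ S) (hα : ∀ v ∉ S, α v = 0) :
    partialSum hG ρ α m S y = weightedSum hG ρ α y := by
  refine tsum_congr fun v => ?_
  by_cases hv : v ∈ S
  · congr 1
    exact Finset.prod_congr rfl fun u hu => if_pos (hS v hv hu)
  · rw [hα v hv, zero_mul, zero_mul]

open Classical in
-- The path to `v` splits at `x`, and every factor strictly below `x` equals `m`.
theorem prod_ancestors_of_mem {v : V} (hx : x ∈ ancestors hG ρ v) (z : V → ℝ≥0∞)
    (hz : ∀ u, x ∈ ancestors hG ρ u → u ≠ x → z u = m) :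
    ∏ u ∈ ancestors hG ρ v, z u =
      (∏ u ∈ (ancestors hG ρ x).erase x, z u) * z x * m ^ G.dist x v := by
  rw [← Finset.prod_sdiff (ancestors_subset hx),
    ← Finset.prod_erase_mul _ _ (self_mem_ancestors hG ρ x), mul_comm]
  congr 1
  rw [← card_ancestors_sdiff hx]
  refine Finset.prod_eq_pow_card fun u hu => ?_
  rw [Finset.mem_sdiff] at hu
  refine hz u ((mem_ancestors_or hx hu.1).resolve_right hu.2) ?_
  rintro rfl
  exact hu.2 (self_mem_ancestors hG ρ u)

open Classical in
-- Only strict descendants of `x` are excluded from `T`, so the same identity serves before and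
-- after `x` is revealed.
theorem partialSum_aux {T : Finset V} (hT : ∀ u, x ∈ ancestors hG ρ u → u ≠ x → u ∉ T)
    (hxT : (ancestors hG ρ x).erase x ⊆ T) :
    partialSum hG ρ α m T y =
      offSum hG ρ α m T x y + coeff hG ρ α m x y * (if x ∈ T then y x else m) := by
  rw [partialSum, weightedSum, offSum, coeff, meanSum_eq hG, mul_assoc,
    mul_comm (∑' _, _) (ite _ _ _), ← mul_assoc, ← ENNReal.tsum_mul_left, ← ENNReal.tsum_add]
  refine tsum_congr fun v => ?_
  by_cases hv : x ∈ ancestors hG ρ v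
  · rw [if_pos hv, if_pos hv, zero_add, prod_ancestors_of_mem hv _ fun u hu hux =>
      if_neg (hT u hu hux), Finset.prod_congr rfl fun u hu => if_pos (hxT hu)]
    ring
  · rw [if_neg hv, if_neg hv, mul_zero, add_zero]

theorem notMem_of_descendant (hS : ∀ v ∈ S, ancestors hG ρ v ⊆ S) (hx : x ∉ S) {u : V}
    (hu : x ∈ ancestors hG ρ u) : u ∉ S :=
  fun h => hx (hS u h hu)

theorem partialSum_eq_offSum_add (hS : ∀ v ∈ S, ancestors hG ρ v ⊆ S) (hx : x ∉ S)
    (hxS : by classical exact (ancestors hG ρ x).erase x ⊆ S) :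
    partialSum hG ρ α m S y = offSum hG ρ α m S x y + coeff hG ρ α m x y * m := by
  classical
  rw [partialSum_aux (x := x) (fun u hu _ => notMem_of_descendant hS hx hu) (by convert hxS),
    if_neg hx]

open Classical in
theorem partialSum_insert (hS : ∀ v ∈ S, ancestors hG ρ v ⊆ S) (hx : x ∉ S)
    (hxS : (ancestors hG ρ x).erase x ⊆ S) :
    partialSum hG ρ α m (insert x S) y = offSum hG ρ α m S x y + coeff hG ρ α m x y * y x := by
  rw [partialSum_aux (x := x) (T := insert x S) _ (hxS.trans (Finset.subset_insert _ _)),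
    if_pos (Finset.mem_insert_self _ _)]
  -- The off-sum only involves vertices that do not have `x` as an ancestor, so adding `x` to `S`
  -- does not change it.
  · congr 1
    refine tsum_congr fun v => ?_
    split_ifs with hv
    · rfl
    · congr 1
      refine Finset.prod_congr rfl fun u hu => ?_
      have : u ≠ x := by rintro rfl; exact hv hu
      simp [this]
  · intro u hu hux h
    exact notMem_of_descendant hS hx hu (Finset.mem_of_mem_insert_of_ne h hux)

open Classical in
theorem partialBracket_insert (hx : x ∉ S) (hxρ : x ≠ ρ) :
    partialBracket hG ρ α m s (insert x S) y =
      partialBracket hG ρ α m s S y + s * coeff hG ρ α m x y ^ 2 := by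
  rw [partialBracket, Finset.sum_insert hx, if_neg hxρ, partialBracket]
  ring

theorem partialBracket_root : partialBracket hG ρ α m s {ρ} y = meanSum G ρ α m ρ ^ 2 := by
  simp [partialBracket]

/-- A vertex outside `S` has its whole sub-tree outside `S`, where the weight vanishes, so its
coefficient is zero. -/
theorem partialBracket_eq_of_support (hS : ∀ v ∈ S, ancestors hG ρ v ⊆ S)
    (hα : ∀ v ∉ S, α v = 0) : partialBracket hG ρ α m s S y = bracket hG ρ α m s y := by
  classical
  rw [partialBracket, bracket, tsum_eq_sum (s := S)]
  intro x hx
  split_ifs with h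
  · rfl
  · rw [coeff, meanSum_eq hG, ENNReal.tsum_eq_zero.2, mul_zero, zero_pow two_ne_zero]
    intro v
    split_ifs with hv
    · rw [hα v (notMem_of_descendant hS hx hv), zero_mul]
    · rfl

theorem mem_children {v : V} : x ∈ children G ρ v ↔ v ∈ ancestors hG ρ x ∧ G.dist v x = 1 := by
  rw [children, Set.mem_ofPred_eq, mem_ancestors, SimpleGraph.dist_comm]

open Classical in
theorem newWeight_eq (hG : G.IsTree) (v : V) : newWeight G ρ α m s v =
    (if v = ρ then meanSum G ρ α m ρ ^ 2 else 0) +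
      s * ∑' x : children G ρ v, meanSum G ρ α m x ^ 2 := by
  rw [newWeight]
  split_ifs with h
  · subst h
    congr 2
    rw [meanSum_eq hG]
    refine tsum_congr fun x => ?_
    rw [if_pos (root_mem_ancestors hG v x), SimpleGraph.dist_comm]
  · rw [zero_add]; rfl

/-- The link between `β` and the martingale: exchange the sums over parents and children. Each
non-root `x` has exactly one parent, and the product over the parent's ancestors is the one in
`coeff`. -/
theorem weightedSum_newWeight (hy1 : y ρ = 1) :
    weightedSum hG ρ (newWeight G ρ α m s) (fun u => y u ^ 2) = bracket hG ρ α m s y := by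
  classical
  simp_rw [weightedSum, newWeight_eq hG, add_mul, Finset.prod_pow]
  rw [ENNReal.tsum_add, bracket]
  congr 1
  · rw [tsum_eq_single ρ fun v hv => by rw [if_neg hv, zero_mul]]
    rw [if_pos rfl, Finset.prod_congr (s₂ := {ρ}) (by ext u; rw [mem_ancestors_root]; simp)
      fun _ _ => rfl]
    simp [hy1]
  · simp_rw [mul_assoc]
    rw [ENNReal.tsum_mul_left]
    congr 1
    simp_rw [← ENNReal.tsum_mul_right]
    have : ∀ v, ∑' x : children G ρ v, meanSum G ρ α m x ^ 2 * (∏ u ∈ ancestors hG ρ v, y u) ^ 2 =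
        ∑' x, if v ∈ ancestors hG ρ x ∧ G.dist v x = 1 then
          meanSum G ρ α m x ^ 2 * (∏ u ∈ ancestors hG ρ v, y u) ^ 2 else 0 := by
      intro v
      rw [tsum_subtype (children G ρ v) fun x =>
        meanSum G ρ α m x ^ 2 * (∏ u ∈ ancestors hG ρ v, y u) ^ 2]
      refine tsum_congr fun x => ?_
      simp only [Set.indicator_apply, mem_children (hG := hG)]
    simp_rw [this]
    rw [ENNReal.tsum_comm]
    refine tsum_congr fun x => ?_
    split_ifs with hx
    · refine ENNReal.tsum_eq_zero.2 fun v => if_neg ?_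
      rintro ⟨h1, h2⟩
      rw [hx, mem_ancestors_root] at h1
      rw [h1, hx, SimpleGraph.dist_self] at h2
      exact absurd h2 (by norm_num)
    · obtain ⟨p, hp, hd⟩ := exists_parent hG ρ hx
      rw [tsum_eq_single p fun v hv => if_neg fun h => hv (parent_unique h.1 h.2 hp hd),
        if_pos ⟨hp, hd⟩, coeff, erase_ancestors hp hd]
      ring

theorem Theta_eq_weightedSum {Ω : Type*} (X : {v : V // v ≠ ρ} → Ω → ℝ) (ω : Ω) :
    Theta hG ρ X α ω = weightedSum hG ρ α fun u => ENNReal.ofReal (withRoot ρ X u ω) := rfl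

end Deterministic

/-! ### Monotone limits in the weight, and truncation to finite support -/

section MonotoneLimit

variable {V : Type*} {G : SimpleGraph V} {hG : G.IsTree} {ρ : V} {m s : ℝ≥0∞}
  {a : ℕ → V → ℝ≥0∞}

theorem tsum_iSup_of_monotone {f : ℕ → V → ℝ≥0∞} (hf : ∀ v, Monotone fun n => f n v) :
    ∑' v, ⨆ n, f n v = ⨆ n, ∑' v, f n v := by
  simp_rw [ENNReal.tsum_eq_iSup_sum]
  rw [iSup_comm]
  refine iSup_congr fun F => ?_
  exact ENNReal.finsetSum_iSup_of_monotone hf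

theorem iSup_rpow_of_monotone {f : ℕ → ℝ≥0∞} {p : ℝ} (hp : 0 < p) :
    (⨆ n, f n) ^ p = ⨆ n, f n ^ p :=
  (ENNReal.orderIsoRpow p hp).map_iSup f

theorem weightedSum_mono {α α' y : V → ℝ≥0∞} (h : α ≤ α') :
    weightedSum hG ρ α y ≤ weightedSum hG ρ α' y :=
  ENNReal.tsum_le_tsum fun v => mul_le_mul_left (h v) _

theorem meanSum_mono {α α' : V → ℝ≥0∞} (h : α ≤ α') (x : V) :
    meanSum G ρ α m x ≤ meanSum G ρ α' m x :=
  ENNReal.tsum_le_tsum fun v => mul_le_mul_left (h v) _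

theorem bracket_mono {α α' y : V → ℝ≥0∞} (h : α ≤ α') :
    bracket hG ρ α m s y ≤ bracket hG ρ α' m s y := by
  classical
  unfold bracket coeff
  gcongr with x
  · exact meanSum_mono h ρ
  · split_ifs
    · rfl
    · gcongr
      exact meanSum_mono h x

theorem weightedSum_iSup (ha : Monotone a) (y : V → ℝ≥0∞) :
    weightedSum hG ρ (⨆ n, a n) y = ⨆ n, weightedSum hG ρ (a n) y := by
  simp_rw [weightedSum, iSup_apply, ENNReal.iSup_mul]
  exact tsum_iSup_of_monotone fun v i j hij => mul_le_mul_left (ha hij v) _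

theorem meanSum_iSup (ha : Monotone a) (x : V) :
    meanSum G ρ (⨆ n, a n) m x = ⨆ n, meanSum G ρ (a n) m x := by
  simp_rw [meanSum, iSup_apply, ENNReal.iSup_mul]
  exact tsum_iSup_of_monotone fun v i j hij => mul_le_mul_left (ha hij v) _

theorem bracket_iSup (ha : Monotone a) (y : V → ℝ≥0∞) :
    bracket hG ρ (⨆ n, a n) m s y = ⨆ n, bracket hG ρ (a n) m s y := by
  classical
  have hW : ∀ x, Monotone fun n => meanSum G ρ (a n) m x := fun x i j hij =>
    meanSum_mono (ha hij) x
  have hsum : ∀ x, Monotone fun n => if x = ρ then (0 : ℝ≥0∞) else coeff hG ρ (a n) m x y ^ 2 := by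
    intro x i j hij
    dsimp only [coeff]
    split_ifs
    · rfl
    · gcongr
      exact hW x hij
  simp_rw [bracket]
  rw [← ENNReal.iSup_add_iSup_of_monotone, ← ENNReal.mul_iSup, ← tsum_iSup_of_monotone hsum]
  · congr 1
    · rw [meanSum_iSup ha, ← ENNReal.rpow_two, iSup_rpow_of_monotone two_pos]
      simp_rw [ENNReal.rpow_two]
    · congr 1
      refine tsum_congr fun x => ?_
      split_ifs
      · simp
      · rw [coeff, meanSum_iSup ha, ENNReal.mul_iSup, ← ENNReal.rpow_two,
          iSup_rpow_of_monotone two_pos]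
        simp_rw [ENNReal.rpow_two]
        rfl
  · intro i j hij
    dsimp only
    gcongr
    exact hW ρ hij
  · intro i j hij
    dsimp only
    gcongr with x
    exact hsum x hij

/-- The restriction of a weight to the first `n` vertices of an enumeration. -/
def truncate [Encodable V] (α : V → ℝ≥0∞) (n : ℕ) (v : V) : ℝ≥0∞ :=
  if Encodable.encode v < n then α v else 0

variable [Encodable V] {α : V → ℝ≥0∞}

theorem truncate_mono : Monotone (truncate α) := by
  intro i j hij v
  unfold truncate
  split_ifs with h1 h2
  · rfl
  · omega
  · exact zero_le
  · rfl

theorem truncate_le (n : ℕ) : truncate α n ≤ α := by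
  intro v
  unfold truncate
  split_ifs
  · rfl
  · exact zero_le

theorem iSup_truncate : ⨆ n, truncate α n = α := by
  refine le_antisymm (iSup_le truncate_le) fun v => ?_
  rw [iSup_apply]
  refine le_iSup_of_le (Encodable.encode v + 1) ?_
  simp [truncate]

theorem exists_support_truncate (n : ℕ) : ∃ F : Finset V, ∀ v ∉ F, truncate α n v = 0 := by
  have hfin : {v : V | Encodable.encode v < n}.Finite :=
    (Set.finite_lt_nat n).preimage Encodable.encode_injective.injOn
  refine ⟨hfin.toFinset, fun v hv => ?_⟩
  rw [Set.Finite.mem_toFinset] at hv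
  exact if_neg hv

end MonotoneLimit

/-! ### Independent factors: measurability and independence of revealed vertices -/

section Probability

variable {V Ω : Type*} {G : SimpleGraph V} {mΩ : MeasurableSpace Ω}

/-- A family of independent non-negative random variables, equal to `1` at the root, with the
moments of the factors at the other vertices that the martingale estimates need. -/
structure IndepFactors (P : Measure Ω) (ρ : V) (q : ℝ) (m s : ℝ≥0∞) (Y : V → Ω → ℝ≥0∞) : Prop where
  measurable : ∀ v, Measurable (Y v)
  root : ∀ ω, Y ρ ω = 1
  ne_top : ∀ v ω, Y v ω ≠ ∞
  indep : iIndepFun (fun v : {v : V // v ≠ ρ} => Y v) P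
  mean_ne_top : m ≠ ∞
  variance_ne_top : s ≠ ∞
  moment_ne_top : ∀ v, v ≠ ρ → ∫⁻ ω, Y v ω ^ q ∂P ≠ ∞
  lintegral_sq : ∀ v, v ≠ ρ → ∀ c b : ℝ≥0∞, c ≠ ∞ → b ≠ ∞ →
    ∫⁻ ω, (c + b * Y v ω) ^ 2 ∂P = (c + b * m) ^ 2 + s * b ^ 2

/-- The σ-algebra generated by the factors at the vertices in `S`. -/
@[reducible]
def revealed (ρ : V) (Y : V → Ω → ℝ≥0∞) (S : Finset V) : MeasurableSpace Ω :=
  ⨆ u ∈ {u : {v : V // v ≠ ρ} | (u : V) ∈ S}, MeasurableSpace.comap (Y u) inferInstance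

variable {P : Measure Ω} {ρ : V} {q : ℝ} {m s : ℝ≥0∞} {Y : V → Ω → ℝ≥0∞}

namespace IndepFactors

theorem revealed_le (h : IndepFactors P ρ q m s Y) (S : Finset V) : revealed ρ Y S ≤ mΩ :=
  iSup₂_le fun u _ => (h.measurable u).comap_le

theorem measurable_revealed (h : IndepFactors P ρ q m s Y) {S : Finset V} {u : V} (hu : u ∈ S) :
    Measurable[revealed ρ Y S] (Y u) := by
  by_cases hρ : u = ρ
  · have : Y u = fun _ => 1 := by rw [hρ]; exact funext h.root
    rw [this]
    exact measurable_const
  · refine Measurable.of_comap_le ?_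
    exact le_iSup₂_of_le (f := fun (v : {v : V // v ≠ ρ}) (_ : v ∈ {v : {v : V // v ≠ ρ} | (v : V) ∈ S}) =>
      MeasurableSpace.comap (Y v) inferInstance) ⟨u, hρ⟩ hu le_rfl

theorem indep_revealed (h : IndepFactors P ρ q m s Y) {S : Finset V} {x : V} (hx : x ∉ S)
    (hxρ : x ≠ ρ) : Indep (revealed ρ Y S) (MeasurableSpace.comap (Y x) inferInstance) P := by
  have := indep_iSup_of_disjoint (fun v : {v : V // v ≠ ρ} => (h.measurable v).comap_le) h.indep
    (S := {u : {v : V // v ≠ ρ} | (u : V) ∈ S}) (T := {⟨x, hxρ⟩})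
    (Set.disjoint_singleton_right.2 hx)
  rwa [iSup_singleton] at this

end IndepFactors

variable {hG : G.IsTree} {α : V → ℝ≥0∞} {S : Finset V} {x : V}

theorem measurable_prod_eval {ℱ : MeasurableSpace Ω} {T : Finset V} {Z : V → Ω → ℝ≥0∞}
    (hZ : ∀ u ∈ T, Measurable[ℱ] (Z u)) : Measurable[ℱ] fun ω => ∏ u ∈ T, Z u ω :=
  Finset.measurable_fun_prod _ hZ

theorem measurable_weightedSum [Countable V] {ℱ : MeasurableSpace Ω} {Z : V → Ω → ℝ≥0∞}
    (hZ : ∀ u, Measurable[ℱ] (Z u)) :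
    Measurable[ℱ] fun ω => weightedSum hG ρ α fun u => Z u ω :=
  Measurable.tsum fun v => (measurable_prod_eval fun u _ => hZ u).const_mul (α v)

theorem measurable_coeff {ℱ : MeasurableSpace Ω}
    (hY : by classical exact ∀ u ∈ (ancestors hG ρ x).erase x, Measurable[ℱ] (Y u)) :
    Measurable[ℱ] fun ω => coeff hG ρ α m x fun u => Y u ω := by
  refine Measurable.mul_const ?_ _
  exact measurable_prod_eval hY

theorem measurable_offSum [Countable V] {ℱ : MeasurableSpace Ω}
    (hY : ∀ u ∈ S, Measurable[ℱ] (Y u)) :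
    Measurable[ℱ] fun ω => offSum hG ρ α m S x fun u => Y u ω := by
  refine Measurable.tsum fun v => ?_
  split_ifs
  · exact measurable_const
  · refine Measurable.const_mul ?_ (α v)
    refine measurable_prod_eval fun u _ => ?_
    split_ifs with hu
    · exact hY u hu
    · exact measurable_const

theorem measurable_partialBracket {ℱ : MeasurableSpace Ω}
    (hS : ∀ v ∈ S, ancestors hG ρ v ⊆ S) (hY : ∀ u ∈ S, Measurable[ℱ] (Y u)) :
    Measurable[ℱ] fun ω => partialBracket hG ρ α m s S fun u => Y u ω := by
  refine Measurable.const_add (Measurable.const_mul ?_ _) _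
  refine Finset.measurable_fun_sum _ fun x hx => ?_
  split_ifs
  · exact measurable_const
  · refine Measurable.pow_const ?_ _
    exact measurable_coeff (by
      classical exact fun u hu => hY u (hS x hx (Finset.mem_of_mem_erase hu)))

theorem measurable_bracket [Countable V] {ℱ : MeasurableSpace Ω}
    (hY : ∀ u, Measurable[ℱ] (Y u)) :
    Measurable[ℱ] fun ω => bracket hG ρ α m s fun u => Y u ω := by
  refine Measurable.const_add (Measurable.const_mul ?_ _) _
  refine Measurable.tsum fun x => ?_
  split_ifs
  · exact measurable_const
  · exact (measurable_coeff fun u _ => hY u).pow_const _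

/-! ### Finite moments for finitely supported weights -/

section Finiteness

theorem sq_rpow_half (z : ℝ≥0∞) (q : ℝ) : (z ^ 2) ^ (q / 2) = z ^ q := by
  rw [← ENNReal.rpow_natCast, ← ENNReal.rpow_mul]; congr 1; push_cast; ring

variable {F : Finset V} {y : V → ℝ≥0∞}

theorem tsum_ne_top_of_support {f : V → ℝ≥0∞} (hF : ∀ v ∉ F, f v = 0) (hf : ∀ v, f v ≠ ∞) :
    ∑' v, f v ≠ ∞ := by
  rw [tsum_eq_sum hF]
  exact ENNReal.sum_ne_top.2 fun v _ => hf v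

theorem meanSum_ne_top (hm : m ≠ ∞) (hF : ∀ v ∉ F, α v = 0) (hα : ∀ v, α v ≠ ∞)
    (hG : G.IsTree) (x : V) : meanSum G ρ α m x ≠ ∞ := by
  classical
  rw [meanSum_eq hG]
  refine tsum_ne_top_of_support (F := F) (fun v hv => ?_) fun v => ?_
  · rw [hF v hv, zero_mul, ite_self]
  · split_ifs
    · exact ENNReal.mul_ne_top (hα v) (ENNReal.pow_ne_top hm)
    · exact ENNReal.zero_ne_top

theorem coeff_ne_top (hm : m ≠ ∞) (hF : ∀ v ∉ F, α v = 0) (hα : ∀ v, α v ≠ ∞)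
    (hy : ∀ v, y v ≠ ∞) : coeff hG ρ α m x y ≠ ∞ :=
  ENNReal.mul_ne_top (ENNReal.prod_ne_top fun u _ => hy u) (meanSum_ne_top hm hF hα hG x)

theorem offSum_ne_top (hm : m ≠ ∞) (hF : ∀ v ∉ F, α v = 0) (hα : ∀ v, α v ≠ ∞)
    (hy : ∀ v, y v ≠ ∞) : offSum hG ρ α m S x y ≠ ∞ := by
  refine tsum_ne_top_of_support (F := F) (fun v hv => ?_) fun v => ?_
  · rw [hF v hv, zero_mul, ite_self]
  · split_ifs
    · exact ENNReal.zero_ne_top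
    · refine ENNReal.mul_ne_top (hα v) (ENNReal.prod_ne_top fun u _ => ?_)
      split_ifs
      · exact hy u
      · exact hm

theorem partialBracket_ne_top (hm : m ≠ ∞) (hs : s ≠ ∞) (hF : ∀ v ∉ F, α v = 0)
    (hα : ∀ v, α v ≠ ∞) (hy : ∀ v, y v ≠ ∞) : partialBracket hG ρ α m s S y ≠ ∞ := by
  refine ENNReal.add_ne_top.2 ⟨ENNReal.pow_ne_top (meanSum_ne_top hm hF hα hG ρ),
    ENNReal.mul_ne_top hs (ENNReal.sum_ne_top.2 fun x _ => ?_)⟩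
  split_ifs
  · exact ENNReal.zero_ne_top
  · exact ENNReal.pow_ne_top (coeff_ne_top hm hF hα hy)

theorem lintegral_finset_sum_rpow_lt_top {ι : Type*} (T : Finset ι) {f : ι → Ω → ℝ≥0∞} {p : ℝ}
    (hp : 1 ≤ p) (hf : ∀ i ∈ T, AEMeasurable (f i) P)
    (hfp : ∀ i ∈ T, ∫⁻ ω, f i ω ^ p ∂P < ∞) : ∫⁻ ω, (∑ i ∈ T, f i ω) ^ p ∂P < ∞ := by
  classical
  induction T using Finset.induction_on with
  | empty =>
    simp [ENNReal.zero_rpow_of_pos (by linarith : 0 < p)]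
  | insert i T hi ih =>
    simp_rw [Finset.sum_insert hi]
    exact ENNReal.lintegral_rpow_add_lt_top_of_lintegral_rpow_lt_top (f := f i)
      (g := fun ω => ∑ j ∈ T, f j ω) (hf i (Finset.mem_insert_self _ _))
      (hfp i (Finset.mem_insert_self _ _))
      (ih (fun j hj => hf j (Finset.mem_insert_of_mem hj))
        fun j hj => hfp j (Finset.mem_insert_of_mem hj)) hp

theorem lintegral_const_mul_rpow_lt_top {f : Ω → ℝ≥0∞} {c : ℝ≥0∞} (hc : c ≠ ∞) {p : ℝ}
    (hp : 0 ≤ p) (hf : ∫⁻ ω, f ω ^ p ∂P < ∞) : ∫⁻ ω, (c * f ω) ^ p ∂P < ∞ := by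
  simp_rw [ENNReal.mul_rpow_of_nonneg _ _ hp]
  rw [lintegral_const_mul' _ _ (ENNReal.rpow_ne_top_of_nonneg hp hc)]
  exact ENNReal.mul_lt_top (ENNReal.rpow_lt_top_of_nonneg hp hc) hf

theorem IndepFactors.lintegral_prod_rpow_lt_top (h : IndepFactors P ρ q m s Y)
    (T : Finset V) (hq : 0 ≤ q) : ∫⁻ ω, (∏ u ∈ T, Y u ω) ^ q ∂P < ∞ := by
  classical
  -- The root factor is `1`; dropping it leaves a product over the independent family.
  have e : ∀ ω, (∏ u ∈ T, Y u ω) ^ q = ∏ u ∈ T.subtype (· ≠ ρ), Y u ω ^ q := by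
    intro ω
    rw [ENNReal.prod_rpow_of_nonneg hq]
    congr 1
    rw [Finset.prod_subtype_eq_prod_filter (s := T) (p := fun v => v ≠ ρ) (fun u => Y u ω)]
    refine (Finset.prod_filter_of_ne fun u _ hu => ?_).symm
    rintro rfl
    exact hu (h.root ω)
  simp_rw [e]
  rw [lintegral_prod_eq_prod_lintegral_of_indepFun _ (fun (v : {v : V // v ≠ ρ}) ω => Y v ω ^ q)
    (h.indep.comp (fun _ z => z ^ q) fun _ => by fun_prop) fun v => (h.measurable v).pow_const q]
  exact ENNReal.prod_lt_top fun v _ => (h.moment_ne_top v v.2).lt_top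

theorem IndepFactors.lintegral_weightedSum_rpow_ne_top (h : IndepFactors P ρ q m s Y)
    (hq : 1 ≤ q) (hF : ∀ v ∉ F, α v = 0) (hα : ∀ v, α v ≠ ∞) :
    ∫⁻ ω, weightedSum hG ρ α (fun u => Y u ω) ^ q ∂P ≠ ∞ := by
  have e : ∀ ω, weightedSum hG ρ α (fun u => Y u ω) =
      ∑ v ∈ F, α v * ∏ u ∈ ancestors hG ρ v, Y u ω := fun ω =>
    tsum_eq_sum fun v hv => by rw [hF v hv, zero_mul]
  simp_rw [e]
  refine (lintegral_finset_sum_rpow_lt_top F hq (fun v _ => ?_) fun v _ => ?_).ne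
  · exact ((measurable_prod_eval fun u _ => h.measurable u).const_mul _).aemeasurable
  · exact lintegral_const_mul_rpow_lt_top (hα v) (by linarith)
      (h.lintegral_prod_rpow_lt_top _ (by linarith))

theorem IndepFactors.lintegral_partialBracket_rpow_ne_top [IsProbabilityMeasure P]
    (h : IndepFactors P ρ q m s Y)
    (hq : 2 ≤ q) (hF : ∀ v ∉ F, α v = 0) (hα : ∀ v, α v ≠ ∞) (S : Finset V) :
    ∫⁻ ω, partialBracket hG ρ α m s S (fun u => Y u ω) ^ (q / 2) ∂P ≠ ∞ := by
  refine (ENNReal.lintegral_rpow_add_lt_top_of_lintegral_rpow_lt_top (f := fun _ => meanSum G ρ α m ρ ^ 2)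
    measurable_const.aemeasurable ?_ ?_ (by linarith : 1 ≤ q / 2)).ne
  · rw [lintegral_const, measure_univ, mul_one]
    exact ENNReal.rpow_lt_top_of_nonneg (by linarith)
      (ENNReal.pow_ne_top (meanSum_ne_top h.mean_ne_top hF hα hG ρ))
  · refine lintegral_const_mul_rpow_lt_top h.variance_ne_top (by linarith) ?_
    refine lintegral_finset_sum_rpow_lt_top S (by linarith) (fun x _ => ?_) fun x _ => ?_
    · split_ifs
      · exact aemeasurable_const
      · exact ((measurable_coeff fun u _ => h.measurable u).pow_const _).aemeasurable
    · split_ifs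
      · simp [ENNReal.zero_rpow_of_pos (by linarith : 0 < q / 2)]
      · simp_rw [sq_rpow_half, coeff, mul_comm _ (meanSum G ρ α m x)]
        exact lintegral_const_mul_rpow_lt_top (meanSum_ne_top h.mean_ne_top hF hα hG x)
          (by linarith) (h.lintegral_prod_rpow_lt_top _ (by linarith))

end Finiteness

/-! ### The two moment inequalities, by induction and then by absorption -/

section Moments

variable [Countable V] [IsProbabilityMeasure P] {F : Finset V}

theorem IndepFactors.lintegral_partialBracket_rpow_le (h : IndepFactors P ρ q m s Y) {r : ℝ}
    (hr : 1 ≤ r) (hF : ∀ v ∉ F, α v = 0) (hα : ∀ v, α v ≠ ∞)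
    (hρS : ρ ∈ S) (hS : ∀ v ∈ S, ancestors hG ρ v ⊆ S) :
    ∫⁻ ω, partialBracket hG ρ α m s S (fun u => Y u ω) ^ r ∂P ≤
      ENNReal.ofReal r * ∫⁻ ω, partialBracket hG ρ α m s S (fun u => Y u ω) ^ (r - 1) *
        partialSum hG ρ α m S (fun u => Y u ω) ^ 2 ∂P := by
  classical
  refine lowerSet_induction (hG := hG) (ρ := ρ) (motive := fun S =>
    ∫⁻ ω, partialBracket hG ρ α m s S (fun u => Y u ω) ^ r ∂P ≤
      ENNReal.ofReal r * ∫⁻ ω, partialBracket hG ρ α m s S (fun u => Y u ω) ^ (r - 1) *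
        partialSum hG ρ α m S (fun u => Y u ω) ^ 2 ∂P) ?_ ?_ S hρS hS
  -- With only the root revealed, the square function is the square of the deterministic martingale
  -- value, and the claim reduces to `1 ≤ r`.
  · simp_rw [fun ω => partialSum_root (hG := hG) (α := α) (m := m)
      (y := fun u => Y u ω) (h.root ω),
      partialBracket_root]
    rw [rpow_sub_one_mul_self hr]
    exact le_mul_of_one_le_left zero_le (by simpa using hr)
  · intro S x hρ hS hx hxS ih
    have hxρ : x ≠ ρ := by rintro rfl; exact hx hρ
    simp_rw [partialBracket_insert hx hxρ, partialSum_insert hS hx hxS]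
    simp_rw [partialSum_eq_offSum_add hS hx hxS] at ih
    exact lintegral_bracket_rpow_le_step (h.revealed_le S)
      (measurable_offSum fun u => h.measurable_revealed)
      (measurable_coeff fun u hu => h.measurable_revealed (hxS hu))
      (measurable_partialBracket hS fun u => h.measurable_revealed)
      (h.measurable x) (h.indep_revealed hx hxρ)
      (fun ω => offSum_ne_top h.mean_ne_top hF hα fun v => h.ne_top v ω)
      (fun ω => coeff_ne_top h.mean_ne_top hF hα fun v => h.ne_top v ω)
      (fun ω => partialBracket_ne_top h.mean_ne_top h.variance_ne_top hF hα fun v => h.ne_top v ω)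
      h.variance_ne_top (h.lintegral_sq x hxρ) hr ih

theorem IndepFactors.lintegral_partialSum_rpow_le (h : IndepFactors P ρ q m s Y) {K κ : ℝ≥0∞}
    (hq : 2 ≤ q)
    (hlow : ∀ v, v ≠ ρ → ∀ c b : ℝ≥0∞,
      (c + b * m) ^ (q - 1) ≤ ∫⁻ ω, (c + b * Y v ω) ^ (q - 1) ∂P)
    (hup : ∀ v, v ≠ ρ → ∀ c b : ℝ≥0∞, c ≠ ∞ → b ≠ ∞ → ∫⁻ ω, (c + b * Y v ω) ^ q ∂P ≤
      (c + b * m) ^ q + K * ((c + b * m) ^ (q - 2) * (s * b ^ 2) + κ * (s * b ^ 2) ^ (q / 2)))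
    (hF : ∀ v ∉ F, α v = 0) (hα : ∀ v, α v ≠ ∞)
    (hρS : ρ ∈ S) (hS : ∀ v ∈ S, ancestors hG ρ v ⊆ S) :
    ∫⁻ ω, partialSum hG ρ α m S (fun u => Y u ω) ^ q ∂P ≤
      2 * K * ∫⁻ ω, partialSum hG ρ α m S (fun u => Y u ω) ^ (q - 1) *
          partialBracket hG ρ α m s S (fun u => Y u ω) ^ (1 / 2 : ℝ) ∂P +
        (1 + K + K * κ) * ∫⁻ ω, partialBracket hG ρ α m s S (fun u => Y u ω) ^ (q / 2) ∂P := by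
  classical
  refine lowerSet_induction (hG := hG) (ρ := ρ) (motive := fun S =>
    ∫⁻ ω, partialSum hG ρ α m S (fun u => Y u ω) ^ q ∂P ≤
      2 * K * ∫⁻ ω, partialSum hG ρ α m S (fun u => Y u ω) ^ (q - 1) *
          partialBracket hG ρ α m s S (fun u => Y u ω) ^ (1 / 2 : ℝ) ∂P +
        (1 + K + K * κ) * ∫⁻ ω, partialBracket hG ρ α m s S (fun u => Y u ω) ^ (q / 2) ∂P)
    ?_ ?_ S hρS hS
  · simp_rw [fun ω => partialSum_root (hG := hG) (α := α) (m := m)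
      (y := fun u => Y u ω) (h.root ω),
      partialBracket_root, sq_rpow_half]
    refine le_add_left (le_mul_of_one_le_left zero_le ?_)
    rw [add_assoc]
    exact le_self_add
  · intro S x hρ hS hx hxS ih
    have hxρ : x ≠ ρ := by rintro rfl; exact hx hρ
    simp_rw [partialBracket_insert hx hxρ, partialSum_insert hS hx hxS]
    simp_rw [partialSum_eq_offSum_add hS hx hxS] at ih
    exact lintegral_rpow_le_step (h.revealed_le S)
      (measurable_offSum fun u => h.measurable_revealed)
      (measurable_coeff fun u hu => h.measurable_revealed (hxS hu))
      (measurable_partialBracket hS fun u => h.measurable_revealed)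
      (h.measurable x) (h.indep_revealed hx hxρ)
      (fun ω => offSum_ne_top h.mean_ne_top hF hα fun v => h.ne_top v ω)
      (fun ω => coeff_ne_top h.mean_ne_top hF hα fun v => h.ne_top v ω)
      (fun ω => partialBracket_ne_top h.mean_ne_top h.variance_ne_top hF hα fun v => h.ne_top v ω)
      h.variance_ne_top h.mean_ne_top hq (hlow x hxρ) (hup x hxρ) ih

theorem IndepFactors.lintegral_bracket_rpow_le_of_support (h : IndepFactors P ρ q m s Y)
    (hq : 2 ≤ q) (hF : ∀ v ∉ F, α v = 0) (hα : ∀ v, α v ≠ ∞) :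
    ∫⁻ ω, bracket hG ρ α m s (fun u => Y u ω) ^ (q / 2) ∂P ≤
      2 * ENNReal.ofReal q ^ (q / 2) * ∫⁻ ω, weightedSum hG ρ α (fun u => Y u ω) ^ q ∂P := by
  classical
  obtain ⟨S, hρS, hFS, hS⟩ := exists_lowerSet_superset (hG := hG) (ρ := ρ) F
  have hαS : ∀ v ∉ S, α v = 0 := fun v hv => hF v fun hvF => hv (hFS hvF)
  have hfin := h.lintegral_partialBracket_rpow_ne_top (hG := hG) hq hF hα S
  have hmain := h.lintegral_partialBracket_rpow_le (r := q / 2) (by linarith) hF hα hρS hS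
  simp_rw [partialSum_eq_of_support hS hαS, partialBracket_eq_of_support hS hαS] at hmain hfin
  have hA : Measurable fun ω => bracket hG ρ α m s (fun u => Y u ω) := measurable_bracket h.measurable
  have hM : Measurable fun ω => weightedSum hG ρ α (fun u => Y u ω) :=
    measurable_weightedSum h.measurable
  rw [mul_assoc]
  refine ennreal_le_two_mul_of_le_half_add hfin (hmain.trans ?_)
  rw [← lintegral_const_mul _ (by fun_prop), ← lintegral_const_mul _ (by fun_prop),
    ENNReal.div_eq_inv_mul, ← lintegral_const_mul _ (by fun_prop),
    ← lintegral_add_left (by fun_prop)]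
  refine lintegral_mono fun ω => ?_
  -- Young with exponent and constant both `q/2`: the factor `(2 · q/2)^(q/2)` is the `q^(q/2)` of
  -- the statement, and absorption doubles it.
  refine (mul_rpow_sub_one_mul_le (by linarith)).trans (le_of_eq ?_)
  rw [sq_rpow_half, ENNReal.div_eq_inv_mul]
  congr 3
  rw [← ENNReal.ofReal_ofNat, ← ENNReal.ofReal_mul (by norm_num)]
  congr 1
  ring

theorem IndepFactors.lintegral_weightedSum_rpow_le_of_support (h : IndepFactors P ρ q m s Y)
    {K κ : ℝ≥0∞} (hq : 2 ≤ q)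
    (hlow : ∀ v, v ≠ ρ → ∀ c b : ℝ≥0∞,
      (c + b * m) ^ (q - 1) ≤ ∫⁻ ω, (c + b * Y v ω) ^ (q - 1) ∂P)
    (hup : ∀ v, v ≠ ρ → ∀ c b : ℝ≥0∞, c ≠ ∞ → b ≠ ∞ → ∫⁻ ω, (c + b * Y v ω) ^ q ∂P ≤
      (c + b * m) ^ q + K * ((c + b * m) ^ (q - 2) * (s * b ^ 2) + κ * (s * b ^ 2) ^ (q / 2)))
    (hF : ∀ v ∉ F, α v = 0) (hα : ∀ v, α v ≠ ∞) :
    ∫⁻ ω, weightedSum hG ρ α (fun u => Y u ω) ^ q ∂P ≤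
      2 * ((4 * K) ^ q + (1 + K + K * κ)) *
        ∫⁻ ω, bracket hG ρ α m s (fun u => Y u ω) ^ (q / 2) ∂P := by
  classical
  obtain ⟨S, hρS, hFS, hS⟩ := exists_lowerSet_superset (hG := hG) (ρ := ρ) F
  have hαS : ∀ v ∉ S, α v = 0 := fun v hv => hF v fun hvF => hv (hFS hvF)
  have hfin := h.lintegral_weightedSum_rpow_ne_top (hG := hG) (by linarith) hF hα
  have hmain := h.lintegral_partialSum_rpow_le hq hlow hup hF hα hρS hS
  simp_rw [partialSum_eq_of_support hS hαS, partialBracket_eq_of_support hS hαS] at hmain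
  have hA : Measurable fun ω => bracket hG ρ α m s (fun u => Y u ω) := measurable_bracket h.measurable
  have hM : Measurable fun ω => weightedSum hG ρ α (fun u => Y u ω) :=
    measurable_weightedSum h.measurable
  rw [mul_assoc]
  refine ennreal_le_two_mul_of_le_half_add hfin (hmain.trans ?_)
  rw [add_mul ((4 * K) ^ q), ← add_assoc]
  refine add_le_add ?_ le_rfl
  rw [← lintegral_const_mul _ (by fun_prop), ← lintegral_const_mul _ (by fun_prop),
    ENNReal.div_eq_inv_mul, ← lintegral_const_mul _ (by fun_prop),
    ← lintegral_add_left (by fun_prop)]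
  refine lintegral_mono fun ω => ?_
  -- Young with exponent `q` and constant `2K`, whence `(4K)^q`.
  refine (mul_rpow_sub_one_mul_le (by linarith : 1 ≤ q)).trans (le_of_eq ?_)
  rw [ENNReal.div_eq_inv_mul, ← ENNReal.rpow_mul, ← mul_assoc 2 2 K]
  congr 3
  · norm_num
  · ring

/-- The constant does not depend on the support, so truncations of `α` can be exhausted by monotone
convergence. -/
theorem IndepFactors.lintegral_bracket_rpow_le (h : IndepFactors P ρ q m s Y)
    (hq : 2 ≤ q) (hα : ∀ v, α v ≠ ∞) :
    ∫⁻ ω, bracket hG ρ α m s (fun u => Y u ω) ^ (q / 2) ∂P ≤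
      2 * ENNReal.ofReal q ^ (q / 2) * ∫⁻ ω, weightedSum hG ρ α (fun u => Y u ω) ^ q ∂P := by
  have := Encodable.ofCountable V
  have e : ∀ ω, bracket hG ρ α m s (fun u => Y u ω) ^ (q / 2) =
      ⨆ n, bracket hG ρ (truncate α n) m s (fun u => Y u ω) ^ (q / 2) := fun ω => by
    rw [← iSup_rpow_of_monotone (by linarith), ← bracket_iSup truncate_mono, iSup_truncate]
  simp_rw [e]
  rw [lintegral_iSup (fun n => (measurable_bracket h.measurable).pow_const _)]
  · refine iSup_le fun n => ?_
    obtain ⟨F, hF⟩ := exists_support_truncate (α := α) n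
    refine (h.lintegral_bracket_rpow_le_of_support hq hF fun v =>
      ((truncate_le n v).trans_lt (hα v).lt_top).ne).trans ?_
    gcongr with ω
    exact weightedSum_mono (truncate_le n)
  · intro i j hij ω
    exact ENNReal.rpow_le_rpow (bracket_mono (truncate_mono hij)) (by linarith)

theorem IndepFactors.lintegral_weightedSum_rpow_le (h : IndepFactors P ρ q m s Y)
    {K κ : ℝ≥0∞} (hq : 2 ≤ q)
    (hlow : ∀ v, v ≠ ρ → ∀ c b : ℝ≥0∞,
      (c + b * m) ^ (q - 1) ≤ ∫⁻ ω, (c + b * Y v ω) ^ (q - 1) ∂P)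
    (hup : ∀ v, v ≠ ρ → ∀ c b : ℝ≥0∞, c ≠ ∞ → b ≠ ∞ → ∫⁻ ω, (c + b * Y v ω) ^ q ∂P ≤
      (c + b * m) ^ q + K * ((c + b * m) ^ (q - 2) * (s * b ^ 2) + κ * (s * b ^ 2) ^ (q / 2)))
    (hα : ∀ v, α v ≠ ∞) :
    ∫⁻ ω, weightedSum hG ρ α (fun u => Y u ω) ^ q ∂P ≤
      2 * ((4 * K) ^ q + (1 + K + K * κ)) *
        ∫⁻ ω, bracket hG ρ α m s (fun u => Y u ω) ^ (q / 2) ∂P := by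
  have := Encodable.ofCountable V
  have e : ∀ ω, weightedSum hG ρ α (fun u => Y u ω) ^ q =
      ⨆ n, weightedSum hG ρ (truncate α n) (fun u => Y u ω) ^ q := fun ω => by
    rw [← iSup_rpow_of_monotone (by linarith), ← weightedSum_iSup truncate_mono, iSup_truncate]
  simp_rw [e]
  rw [lintegral_iSup (fun n => (measurable_weightedSum h.measurable).pow_const _)]
  · refine iSup_le fun n => ?_
    obtain ⟨F, hF⟩ := exists_support_truncate (α := α) n
    refine (h.lintegral_weightedSum_rpow_le_of_support hq hlow hup hF fun v =>
      ((truncate_le n v).trans_lt (hα v).lt_top).ne).trans ?_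
    gcongr with ω
    exact bracket_mono (truncate_le n)
  · intro i j hij ω
    exact ENNReal.rpow_le_rpow (weightedSum_mono (truncate_mono hij)) (by linarith)

end Moments

end Probability

/-! ### From identically distributed copies to the abstract moment hypotheses -/

section Copies

variable {V Ω Ω₀ : Type*} {G : SimpleGraph V} {hG : G.IsTree} {ρ : V} {mΩ : MeasurableSpace Ω}
  {P : Measure Ω} {mΩ₀ : MeasurableSpace Ω₀} {P₀ : Measure Ω₀}
  {X : Ω₀ → ℝ} {q : ℝ} {Z : {v : V // v ≠ ρ} → Ω → ℝ}

theorem withRoot_root (ω : Ω) : withRoot ρ Z ρ ω = 1 := dif_pos rfl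

theorem withRoot_of_ne {v : V} (hv : v ≠ ρ) (ω : Ω) : withRoot ρ Z v ω = Z ⟨v, hv⟩ ω := dif_neg hv

theorem ae_nonneg_of_identDistrib {Y : Ω → ℝ} (h : IdentDistrib Y X P P₀)
    (h0 : ∀ᵐ ω ∂P₀, 0 ≤ X ω) : ∀ᵐ ω ∂P, 0 ≤ Y ω :=
  h.symm.ae_snd measurableSet_Ici h0

variable [IsProbabilityMeasure P]

theorem indepFactors_of_identDistrib (hq : 2 ≤ q) (hX : MemLp X (ENNReal.ofReal q) P₀)
    (h0 : ∀ᵐ ω ∂P₀, 0 ≤ X ω) (hZm : ∀ v, Measurable (Z v)) (hZ : iIndepFun Z P)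
    (hid : ∀ v, IdentDistrib (Z v) X P P₀) :
    IndepFactors P ρ q (ENNReal.ofReal (∫ ω, X ω ∂P₀)) (ENNReal.ofReal (variance X P₀))
      (fun v ω => ENNReal.ofReal (withRoot ρ Z v ω)) where
  measurable v := by
    by_cases hv : v = ρ
    · subst hv
      simp_rw [withRoot_root]
      exact measurable_const
    · simp_rw [withRoot_of_ne hv]
      exact (hZm _).ennreal_ofReal
  root ω := by simp [withRoot_root]
  ne_top v ω := ENNReal.ofReal_ne_top
  indep := by
    have e : (fun (v : {v : V // v ≠ ρ}) ω => ENNReal.ofReal (withRoot ρ Z v ω)) =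
        fun v => ENNReal.ofReal ∘ Z v := by
      ext v ω
      rw [withRoot_of_ne v.2]; rfl
    rw [e]
    exact hZ.comp (fun _ => ENNReal.ofReal) fun _ => ENNReal.measurable_ofReal
  mean_ne_top := ENNReal.ofReal_ne_top
  variance_ne_top := ENNReal.ofReal_ne_top
  moment_ne_top v hv := by
    simp_rw [withRoot_of_ne hv]
    have hL := (hid ⟨v, hv⟩).memLp_iff.2 hX
    have := lintegral_rpow_enorm_lt_top_of_eLpNorm_lt_top (by simp; linarith) (by simp) hL.2
    rw [ENNReal.toReal_ofReal (by linarith)] at this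
    refine (lt_of_le_of_lt (lintegral_mono fun ω => ?_) this).ne
    exact ENNReal.rpow_le_rpow (by
      rw [Real.enorm_eq_ofReal_abs]; exact ENNReal.ofReal_le_ofReal (le_abs_self _)) (by linarith)
  lintegral_sq v hv c b hc hb := by
    simp_rw [withRoot_of_ne hv]
    have hid := hid ⟨v, hv⟩
    rw [lintegral_sq_const_add_mul (memLp_two_of_two_le hq (hid.memLp_iff.2 hX))
      (ae_nonneg_of_identDistrib hid h0) hc hb, hid.integral_eq, hid.variance_eq]

theorem rpow_le_lintegral_of_identDistrib (hq : 2 ≤ q) (hX : MemLp X (ENNReal.ofReal q) P₀)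
    (h0 : ∀ᵐ ω ∂P₀, 0 ≤ X ω) {Y : Ω → ℝ} (hid : IdentDistrib Y X P P₀) (c b : ℝ≥0∞) :
    (c + b * ENNReal.ofReal (∫ ω, X ω ∂P₀)) ^ (q - 1) ≤
      ∫⁻ ω, (c + b * ENNReal.ofReal (Y ω)) ^ (q - 1) ∂P := by
  rw [← hid.integral_eq]
  exact rpow_le_lintegral_const_add_mul (memLp_two_of_two_le hq (hid.memLp_iff.2 hX))
    (ae_nonneg_of_identDistrib hid h0) (by linarith) c b

/-- Dividing by `Var(X)^(q/2)` expresses the `q`-th moment of the increment through its variance `s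
b^2`, the quantity summed in the square function. Positive variance is needed for this cancellation.
-/
theorem lintegral_rpow_le_of_identDistrib (hq : 2 ≤ q) (hX : MemLp X (ENNReal.ofReal q) P₀)
    (h0 : ∀ᵐ ω ∂P₀, 0 ≤ X ω) (hvar : 0 < variance X P₀) {Y : Ω → ℝ}
    (hid : IdentDistrib Y X P P₀) {c b : ℝ≥0∞} (hc : c ≠ ∞) (hb : b ≠ ∞) :
    ∫⁻ ω, (c + b * ENNReal.ofReal (Y ω)) ^ q ∂P ≤
      (c + b * ENNReal.ofReal (∫ ω, X ω ∂P₀)) ^ q + ENNReal.ofReal (2 ^ q * q ^ 2) *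
        ((c + b * ENNReal.ofReal (∫ ω, X ω ∂P₀)) ^ (q - 2) *
            (ENNReal.ofReal (variance X P₀) * b ^ 2) +
          (∫⁻ ω, ‖X ω - ∫ ω', X ω' ∂P₀‖ₑ ^ q ∂P₀) / ENNReal.ofReal (variance X P₀) ^ (q / 2) *
            (ENNReal.ofReal (variance X P₀) * b ^ 2) ^ (q / 2)) := by
  refine (lintegral_rpow_const_add_mul_le hq (hid.memLp_iff.2 hX)
    (ae_nonneg_of_identDistrib hid h0) hc hb).trans (le_of_eq ?_)
  have e : ∫⁻ ω, ‖Y ω - ∫ ω', X ω' ∂P₀‖ₑ ^ q ∂P = ∫⁻ ω, ‖X ω - ∫ ω', X ω' ∂P₀‖ₑ ^ q ∂P₀ :=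
    (hid.comp (u := fun x => ‖x - ∫ ω', X ω' ∂P₀‖ₑ ^ q) (by fun_prop)).lintegral_eq
  have hs : ENNReal.ofReal (variance X P₀) ≠ 0 := by simpa using hvar
  rw [hid.integral_eq, hid.variance_eq, e, ENNReal.mul_rpow_of_nonneg _ _ (by linarith),
    sq_rpow_half, ← mul_assoc (_ / _),
    ENNReal.div_mul_cancel (by simp [hs]) (ENNReal.rpow_ne_top_of_nonneg (by linarith)
      ENNReal.ofReal_ne_top)]

end Copies

end TreeSum

/-! ### Assembly of the theorem -/

theorem mainTheorem4 (q : ℝ) (hq : 2 ≤ q) :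
    ∃ c C : ℝ≥0, 0 < c ∧ 0 < C ∧
      ∀ (V : Type*) (_ : Countable V) (G : SimpleGraph V) (hG : G.IsTree) (ρ : V)
        (α : V → ℝ≥0)
        -- the random variable `X`
        (Ω₀ : Type*) (_ : MeasurableSpace Ω₀) (P₀ : Measure Ω₀) (_ : IsProbabilityMeasure P₀)
        (X : Ω₀ → ℝ) (_ : AEMeasurable X P₀) (_ : ∀ᵐ ω ∂P₀, 0 ≤ X ω)
        (_ : Integrable (fun ω => X ω ^ q) P₀)
        -- independent copies of `X`, indexed by the non-root vertices
        (Ω : Type*) (_ : MeasurableSpace Ω) (P : Measure Ω) (_ : IsProbabilityMeasure P)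
        (Xs : {v : V // v ≠ ρ} → Ω → ℝ) (_ : iIndepFun Xs P)
        (_ : ∀ v, IdentDistrib (Xs v) X P P₀)
        -- the new weight
        (β : V → ℝ≥0∞)
        (_ : β = TreeSum.newWeight G ρ (fun v => (α v : ℝ≥0∞))
          (ENNReal.ofReal (∫ ω, X ω ∂P₀)) (ENNReal.ofReal (variance X P₀))),
        -- the lower bound
        (c : ℝ≥0∞) * ∫⁻ ω, TreeSum.Theta hG ρ (fun v ω => Xs v ω ^ 2) β ω ^ (q / 2) ∂P
            ≤ ∫⁻ ω, TreeSum.Theta hG ρ Xs (fun v => (α v : ℝ≥0∞)) ω ^ q ∂P ∧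
        -- the upper bound
        (0 < variance X P₀ →
          ∫⁻ ω, TreeSum.Theta hG ρ Xs (fun v => (α v : ℝ≥0∞)) ω ^ q ∂P
            ≤ (C : ℝ≥0∞) *
                (eLpNorm (fun ω => X ω - ∫ ω', X ω' ∂P₀) (ENNReal.ofReal q) P₀ ^ q /
                  ENNReal.ofReal (variance X P₀) ^ (q / 2)) *
                ∫⁻ ω, TreeSum.Theta hG ρ (fun v ω => Xs v ω ^ 2) β ω ^ (q / 2) ∂P) ∧
        -- the degenerate case, where the quotient in the upper bound is `0 / 0`
        (variance X P₀ = 0 →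
          ∫⁻ ω, TreeSum.Theta hG ρ Xs (fun v => (α v : ℝ≥0∞)) ω ^ q ∂P
            = ∫⁻ ω, TreeSum.Theta hG ρ (fun v ω => Xs v ω ^ 2) β ω ^ (q / 2) ∂P) := by
  have hq0 : 0 < q.toNNReal := by simpa using by linarith
  set K : ℝ≥0 := (2 ^ q * q ^ 2).toNNReal with hK
  refine ⟨(2 * q.toNNReal ^ (q / 2))⁻¹, 2 * ((4 * K) ^ q + (1 + 2 * K)), ?_, ?_, ?_⟩
  · exact inv_pos.2 (mul_pos two_pos (NNReal.rpow_pos hq0))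
  · positivity
  intro V _ G hG ρ α Ω₀ _ P₀ _ X hXm h0 hXi Ω _ P _ Xs hind hid β hβ
  have hX : MemLp X (ENNReal.ofReal q) P₀ :=
    TreeSum.memLp_of_integrable_rpow (by linarith) hXm h0 hXi
  -- The copies are only a.e. measurable; measurable modifications make the revealed σ-algebras
  -- sub-σ-algebras of the ambient one.
  set Z : {v : V // v ≠ ρ} → Ω → ℝ := fun v => (hid v).aemeasurable_fst.mk (Xs v) with hZ
  have hae : ∀ v, Xs v =ᵐ[P] Z v := fun v => (hid v).aemeasurable_fst.ae_eq_mk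
  have hZm : ∀ v, Measurable (Z v) := fun v => (hid v).aemeasurable_fst.measurable_mk
  have hZid : ∀ v, IdentDistrib (Z v) X P P₀ := fun v =>
    (IdentDistrib.of_ae_eq (hid v).aemeasurable_fst (hae v)).symm.trans (hid v)
  have hF := TreeSum.indepFactors_of_identDistrib hq hX h0 hZm (hind.congr hae) hZid
  set s := ENNReal.ofReal (variance X P₀) with hs
  set m := ENNReal.ofReal (∫ ω, X ω ∂P₀) with hm
  set a : V → ℝ≥0∞ := fun v => (α v : ℝ≥0∞) with ha
  have haf : ∀ v, a v ≠ ∞ := fun v => ENNReal.coe_ne_top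
  have hall : ∀ᵐ ω ∂P, ∀ v, Xs v ω = Z v ω ∧ 0 ≤ Z v ω := by
    rw [ae_all_iff]
    intro v
    filter_upwards [hae v, TreeSum.ae_nonneg_of_identDistrib (hZid v) h0] with ω h1 h2
    exact ⟨h1, h2⟩
  have hΘ : ∀ᵐ ω ∂P, TreeSum.Theta hG ρ Xs a ω ^ q =
      TreeSum.weightedSum hG ρ a (fun v => ENNReal.ofReal (TreeSum.withRoot ρ Z v ω)) ^ q := by
    filter_upwards [hall] with ω hω
    rw [TreeSum.Theta_eq_weightedSum]
    congr 2
    ext v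
    by_cases hv : v = ρ
    · rw [hv, TreeSum.withRoot_root, TreeSum.withRoot_root]
    · rw [TreeSum.withRoot_of_ne hv, TreeSum.withRoot_of_ne hv, (hω _).1]
  have hA : ∀ᵐ ω ∂P, TreeSum.Theta hG ρ (fun v ω => Xs v ω ^ 2) β ω ^ (q / 2) =
      TreeSum.bracket hG ρ a m s
        (fun v => ENNReal.ofReal (TreeSum.withRoot ρ Z v ω)) ^ (q / 2) := by
    filter_upwards [hall] with ω hω
    rw [TreeSum.Theta_eq_weightedSum, hβ, ← TreeSum.weightedSum_newWeight
      (y := fun v => ENNReal.ofReal (TreeSum.withRoot ρ Z v ω)) (hF.root ω)]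
    congr 2
    ext v
    by_cases hv : v = ρ
    · rw [hv, TreeSum.withRoot_root, TreeSum.withRoot_root]; simp
    · rw [TreeSum.withRoot_of_ne hv, TreeSum.withRoot_of_ne hv, (hω _).1,
        ENNReal.ofReal_pow (hω _).2]
  rw [lintegral_congr_ae hΘ, lintegral_congr_ae hA]
  refine ⟨?_, fun hvar => ?_, fun hvar => ?_⟩
  · have h := hF.lintegral_bracket_rpow_le (hG := hG) hq haf
    have hc : ((2 * q.toNNReal ^ (q / 2) : ℝ≥0) : ℝ≥0∞) = 2 * ENNReal.ofReal q ^ (q / 2) := by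
      rw [ENNReal.coe_mul, ENNReal.coe_rpow_of_nonneg _ (by linarith)]; rfl
    have hne : 2 * q.toNNReal ^ (q / 2) ≠ 0 := (mul_pos two_pos (NNReal.rpow_pos hq0)).ne'
    rw [← hc] at h
    refine (mul_le_mul_right h _).trans (le_of_eq ?_)
    rw [← mul_assoc, ← ENNReal.coe_mul, inv_mul_cancel₀ hne, ENNReal.coe_one, one_mul]
  · set κ := (∫⁻ ω, ‖X ω - ∫ ω', X ω' ∂P₀‖ₑ ^ q ∂P₀) / s ^ (q / 2) with hκ
    have hs0 : s ≠ 0 := by simpa [hs] using hvar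
    have hκ1 : 1 ≤ κ := by
      rw [hκ, ENNReal.le_div_iff_mul_le (Or.inl fun h => hs0 ((ENNReal.rpow_eq_zero_iff_of_pos (by linarith)).1 h))
        (Or.inl (ENNReal.rpow_ne_top_of_nonneg (by linarith) ENNReal.ofReal_ne_top)), one_mul]
      exact TreeSum.variance_rpow_le hq hX
    have hnorm : eLpNorm (fun ω => X ω - ∫ ω', X ω' ∂P₀) (ENNReal.ofReal q) P₀ ^ q =
        ∫⁻ ω, ‖X ω - ∫ ω', X ω' ∂P₀‖ₑ ^ q ∂P₀ := by
      rw [eLpNorm_eq_lintegral_rpow_enorm_toReal (by simp; linarith) (by simp),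
        ENNReal.toReal_ofReal (by linarith), ← ENNReal.rpow_mul, one_div,
        inv_mul_cancel₀ (by linarith), ENNReal.rpow_one]
    rw [hnorm, ← hκ]
    refine (hF.lintegral_weightedSum_rpow_le (hG := hG) (K := K) (κ := κ) hq
      (fun v hv c b => ?_) (fun v hv c b hc hb => ?_) haf).trans ?_
    · simp_rw [TreeSum.withRoot_of_ne hv]
      exact TreeSum.rpow_le_lintegral_of_identDistrib hq hX h0 (hZid _) c b
    · simp_rw [TreeSum.withRoot_of_ne hv]
      exact TreeSum.lintegral_rpow_le_of_identDistrib hq hX h0 hvar (hZid _) hc hb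
    · have hC : ((2 * ((4 * K) ^ q + (1 + 2 * K)) : ℝ≥0) : ℝ≥0∞) =
          2 * ((4 * (K : ℝ≥0∞)) ^ q + (1 + 2 * K)) := by
        rw [ENNReal.coe_mul, ENNReal.coe_add, ENNReal.coe_rpow_of_nonneg _ (by linarith)]
        push_cast
        rfl
      rw [hC, mul_assoc 2 _ κ]
      refine mul_le_mul_left (mul_le_mul_right ?_ 2) _
      -- Since `κ ≥ 1`, every term without `κ` may be multiplied by it, leaving a constant that
      -- depends on `q` alone.
      calc (4 * (K : ℝ≥0∞)) ^ q + (1 + K + K * κ)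
          ≤ (4 * (K : ℝ≥0∞)) ^ q * κ + (1 * κ + K * κ + K * κ) := by
            gcongr
            · exact le_mul_of_one_le_right zero_le hκ1
            · rwa [one_mul]
            · exact le_mul_of_one_le_right zero_le hκ1
        _ = ((4 * (K : ℝ≥0∞)) ^ q + (1 + 2 * K)) * κ := by ring
  · have hs0 : s = 0 := by rw [hs, hvar, ENNReal.ofReal_zero]
    -- With zero variance every factor is a.s. its mean, so the sum is the root mean sum and the
    -- square function is its square.
    have hconst : ∀ᵐ ω ∂P, ∀ v, Z v ω = ∫ ω', X ω' ∂P₀ := by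
      rw [ae_all_iff]
      intro v
      have := ae_eq_integral_of_variance_eq_zero
        (TreeSum.memLp_two_of_two_le hq ((hZid v).memLp_iff.2 hX))
        (by rw [(hZid v).variance_eq, hvar])
      rwa [(hZid v).integral_eq] at this
    refine lintegral_congr_ae ?_
    filter_upwards [hconst] with ω hω
    rw [TreeSum.weightedSum_const (y := fun v => ENNReal.ofReal (TreeSum.withRoot ρ Z v ω)) m
      (hF.root ω) fun u hu => by rw [TreeSum.withRoot_of_ne hu, hω], TreeSum.bracket, hs0, zero_mul, add_zero,
      TreeSum.sq_rpow_half]
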